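/- A \emph{convex combination (CC) space} is a metric space $(\mathfrak X,d)$ with an operation assigning to $n\ge 1$, weights $\lambda_1,\dots,\lambda_n>0$ with $\sum_i\lambda_i=1$ and points $u_1,\dots,u_n\in\mathfrak X$ a point $[\lambda_i,u_i]_{i=1}^n=[\lambda_1,u_1;\dots;\lambda_n,u_n]\in\mathfrak X$ such that $[1,u]=u$ and: (i) $[\lambda_i,u_i]_{i=1}^n=[\lambda_{\sigma(i)},u_{\sigma(i)}]_{i=1}^n$ for every permutation $\sigma$; (ii) $[\lambda_i,u_i]_{i=1}^{n+2}=\bigl[\lambda_1,u_1;\dots;\lambda_n,u_n;\lambda_{n+1}+\lambda_{n+2},\bigl[\tfrac{\lambda_{n+j}}{\lambda_{n+1}+\lambda_{n+2}},u_{n+j}\bigr]_{j=1}^{2}\bigr]$; (iii) if $\lambda^{(k)}\to\lambda$ with $\lambda^{(k)},\lambda\in(0,1)$, then $[\lambda^{(k)},u;1-\lambda^{(k)},v]\to[\lambda,u;1-\lambda,v]$; (iv) $d([\lambda,u_1;1-\lambda,u_2],[\lambda,v_1;1-\lambda,v_2])\le\lambda d(u_1,v_1)+(1-\lambda)d(u_2,v_2)$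 for $\lambda\in(0,1)$; (v) for every $u$ the limit $Ku=\lim_{n\to\infty}[n^{-1},u]_{i=1}^n$ exists. The set $K(\mathfrak X)=\{Ku:u\in\mathfrak X\}$, with the metric and convex combinations of $\mathfrak X$, is again a CC space. Let $\mathfrak X$ be a separable complete (nonempty) CC space and $(\Omega,\mathcal F,P)$ a probability space. A \emph{random element} is a Borel measurable map $X:\Omega\to\mathfrak X$; it is \emph{integrable} if $E\,d(a,X)<\infty$ for some $a\in\mathfrak X$. If $X$ is simple with distinct values $x_1,\dots,x_n$ of positive probability, put $EX=[P(X=x_i),Kx_i]_{i=1}^n$. In general, fix $u_0\in K(\mathfrak X)$ and a sequence $(u_j)_{j\ge1}$ with dense range in $\mathfrak X$, let $\psi_n(x)$ be the point nearest to $x$ among $u_0,\dots,u_n$ (the one of least index in case of ties), and put $EX=\lim_{n\to\infty}E\psi_n(X)$. Expectations of $K(\mathfrak X)$-valued random elements are defined in the same way in the CC space $K(\mathfrak X)$. \textbf{Theorem.} There are a separable real Banach space $\mathbb E$ and a map $j:K(\mathfrak X)\to\mathbb E$ such that $j(K(\mathfrak X))$ is closed and convex, $j([\lambda,x;1-\lambda,y])=\lambda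 j(x)+(1-\lambda)j(y)$ for $x,y\in K(\mathfrak X)$, $\lambda\in(0,1)$, and $d(x,y)=\|j(x)-j(y)\|$ for $x,y\in K(\mathfrak X)$. For every real Banach space $\mathbb E$ and every map $j$ with these three properties, and for every choice of the sequences used to define the expectations in $\mathfrak X$ and in $K(\mathfrak X)$, the following holds. If $X$ is an integrable $\mathfrak X$-valued random element, then $KX$ is an integrable $K(\mathfrak X)$-valued random element, the limits defining $EX$ and $E(KX)$ exist, $EX\in K(\mathfrak X)$, $j(KX)$ is Bochner integrable, and $$j(EX)=j(E(KX))=E\,j(KX),$$ where $E\,j(KX)$ is the Bochner integral. In particular, if $X$ is an integrable $K(\mathfrak X)$-valued random element, then $EX$ exists (and is the same whether formed in $K(\mathfrak X)$ or in $\mathfrak X$), $j(X)$ is Bochner integrable, and $j(EX)=E\,j(X)$. -/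

import Mathlib

open MeasureTheory Filter Topology

/-- Admissible weights of a convex combination: positive reals with sum `1`
(so there is at least one of them). -/
structure IsWeight {n : ℕ} (w : Fin n → ℝ) : Prop where
  pos : ∀ i, 0 < w i
  sum_eq_one : ∑ i, w i = 1

/-- A convex combination space: a metric space with an operation
`[w₁, u₁; …; wₙ, uₙ] = comb w u`.  The operation is only meaningful (and only constrained by the
axioms) for admissible weights `w`. -/
class ConvexCombSpace (𝔛 : Type*) [MetricSpace 𝔛] where
  comb : ∀ {n : ℕ}, (Fin n → ℝ) → (Fin n → 𝔛) → 𝔛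
  /-- `[1, u] = u` -/
  comb_one : ∀ u : 𝔛, comb ![1] ![u] = u
  /-- commutativity -/
  comb_perm : ∀ {n : ℕ} (w : Fin n → ℝ) (u : Fin n → 𝔛) (σ : Equiv.Perm (Fin n)), IsWeight w →
    comb w u = comb (w ∘ σ) (u ∘ σ)
  /-- associativity -/
  comb_assoc : ∀ {n : ℕ} (w : Fin n → ℝ) (a b : ℝ) (u : Fin n → 𝔛) (x y : 𝔛),
    IsWeight (Fin.snoc (Fin.snoc w a : Fin (n + 1) → ℝ) b : Fin (n + 2) → ℝ) →
    comb (Fin.snoc (Fin.snoc w a : Fin (n + 1) → ℝ) b : Fin (n + 2) → ℝ)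
        (Fin.snoc (Fin.snoc u x : Fin (n + 1) → 𝔛) y : Fin (n + 2) → 𝔛) =
      comb (Fin.snoc w (a + b) : Fin (n + 1) → ℝ)
        (Fin.snoc u (comb ![a / (a + b), b / (a + b)] ![x, y]) : Fin (n + 1) → 𝔛)
  /-- continuity in the weight -/
  comb_continuous : ∀ (u v : 𝔛) (l : ℕ → ℝ) (l₀ : ℝ), (∀ k, l k ∈ Set.Ioo (0 : ℝ) 1) →
    l₀ ∈ Set.Ioo (0 : ℝ) 1 → Tendsto l atTop (𝓝 l₀) →
    Tendsto (fun k => comb ![l k, 1 - l k] ![u, v]) atTop (𝓝 (comb ![l₀, 1 - l₀] ![u, v]))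
  /-- negative curvature -/
  dist_comb_le : ∀ (u₁ u₂ v₁ v₂ : 𝔛) (l : ℝ), l ∈ Set.Ioo (0 : ℝ) 1 →
    dist (comb ![l, 1 - l] ![u₁, u₂]) (comb ![l, 1 - l] ![v₁, v₂]) ≤
      l * dist u₁ v₁ + (1 - l) * dist u₂ v₂
  /-- convexification: `[n⁻¹, u]_{i=1}^n` converges -/
  exists_convexification : ∀ u : 𝔛, ∃ k : 𝔛,
    Tendsto (fun n : ℕ => comb (fun _ : Fin (n + 1) => ((n : ℝ) + 1)⁻¹) (fun _ => u)) atTop (𝓝 k)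

namespace ConvexCombSpace

section Basic

variable {𝔛 : Type*} [MetricSpace 𝔛] [ConvexCombSpace 𝔛]

/-- The convexification operator `K u = lim [n⁻¹, u]_{i=1}^n`. -/
noncomputable def convexify (u : 𝔛) : 𝔛 := (exists_convexification u).choose

theorem tendsto_convexify (u : 𝔛) :
    Tendsto (fun n : ℕ => comb (fun _ : Fin (n + 1) => ((n : ℝ) + 1)⁻¹) (fun _ => u)) atTop
      (𝓝 (convexify u)) := (exists_convexification u).choose_spec

variable (𝔛) in
/-- The convexifiable domain `K(𝔛)`. -/
def convexDomain : Set 𝔛 := Set.range (convexify : 𝔛 → 𝔛)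

/-- `K` as a map onto its image `K(𝔛)`. -/
noncomputable def toDomain (u : 𝔛) : convexDomain 𝔛 := ⟨convexify u, u, rfl⟩

end Basic

section Domain

/-! `K(𝔛)` is closed under convex combinations, hence is itself a convex combination space. -/

variable {𝔛 : Type*} [MetricSpace 𝔛] [ConvexCombSpace 𝔛]

theorem comb_cons {n : ℕ} : ∀ (a : ℝ) (w : Fin (n + 1) → ℝ) (x : 𝔛) (u : Fin (n + 1) → 𝔛),
    IsWeight (Fin.cons a w : Fin (n + 2) → ℝ) →
    comb (Fin.cons a w : Fin (n + 2) → ℝ) (Fin.cons x u : Fin (n + 2) → 𝔛) =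
      comb ![a, 1 - a] ![x, comb (fun i => w i / (1 - a)) u] := by
  induction n with
  | zero =>
    intro a w x u hw
    have hs := hw.sum_eq_one
    have hp := hw.pos 1
    simp [Fin.sum_univ_succ] at hs
    have hp' : 0 < w 0 := by simpa using hp
    have h1 : (fun i : Fin 1 => w i / (1 - a)) = ![1] := by
      ext i; fin_cases i; simp; rw [div_eq_one_iff_eq] <;> linarith
    have h2 : u = ![u 0] := by ext i; fin_cases i; rfl
    rw [h1, h2, comb_one]
    congr 1
    · ext i; fin_cases i
      · rfl
      · simp; linarith
  | succ n ih =>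
    intro a w x u hw
    obtain ⟨w, b, rfl⟩ : ∃ (w' : Fin (n + 1) → ℝ) (b : ℝ), w = Fin.snoc w' b :=
      ⟨Fin.init w, w (Fin.last _), (Fin.snoc_init_self w).symm⟩
    obtain ⟨w, c, rfl⟩ : ∃ (w' : Fin n → ℝ) (b : ℝ), w = Fin.snoc w' b :=
      ⟨Fin.init w, w (Fin.last _), (Fin.snoc_init_self w).symm⟩
    obtain ⟨u, y, rfl⟩ : ∃ (u' : Fin (n + 1) → 𝔛) (b : 𝔛), u = Fin.snoc u' b :=
      ⟨Fin.init u, u (Fin.last _), (Fin.snoc_init_self u).symm⟩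
    obtain ⟨u, z, rfl⟩ : ∃ (u' : Fin n → 𝔛) (b : 𝔛), u = Fin.snoc u' b :=
      ⟨Fin.init u, u (Fin.last _), (Fin.snoc_init_self u).symm⟩
    have hs := hw.sum_eq_one
    rw [Fin.sum_univ_succ] at hs
    simp only [Fin.cons_zero, Fin.cons_succ, Fin.sum_univ_castSucc (n := n + 1),
      Fin.sum_univ_castSucc (n := n), Fin.snoc_castSucc, Fin.snoc_last] at hs
    have ha : 0 < a := by simpa using hw.pos 0
    have hpw : ∀ i, 0 < w i := fun i => by
      have := hw.pos i.castSucc.castSucc.succ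
      simpa only [Fin.cons_succ, Fin.snoc_castSucc] using this
    have hc : 0 < c := by
      have := hw.pos (Fin.last n).castSucc.succ
      simpa only [Fin.cons_succ, Fin.snoc_castSucc, Fin.snoc_last] using this
    have hb : 0 < b := by
      have := hw.pos (Fin.last (n + 1)).succ
      simpa only [Fin.cons_succ, Fin.snoc_last] using this
    have hsw : 0 ≤ ∑ i, w i := Finset.sum_nonneg fun i _ => (hpw i).le
    have h1a : 0 < 1 - a := by linarith
    rw [Fin.cons_snoc_eq_snoc_cons, Fin.cons_snoc_eq_snoc_cons, Fin.cons_snoc_eq_snoc_cons,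
      Fin.cons_snoc_eq_snoc_cons] at *
    rw [comb_assoc _ _ _ _ _ _ hw, ← Fin.cons_snoc_eq_snoc_cons, ← Fin.cons_snoc_eq_snoc_cons,
      ih]
    · have e1 : (fun i => (Fin.snoc w (c + b) : Fin (n + 1) → ℝ) i / (1 - a)) =
          (Fin.snoc (fun i => w i / (1 - a)) (c / (1 - a) + b / (1 - a)) : Fin (n + 1) → ℝ) := by
        ext i
        refine Fin.lastCases ?_ (fun i => ?_) i
        · simp; ring
        · simp
      have e2 : (fun i => (Fin.snoc (Fin.snoc w c : Fin (n + 1) → ℝ) b : Fin (n + 2) → ℝ) i /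
          (1 - a)) = (Fin.snoc (Fin.snoc (fun i => w i / (1 - a)) (c / (1 - a)) :
            Fin (n + 1) → ℝ) (b / (1 - a)) : Fin (n + 2) → ℝ) := by
        ext i
        refine Fin.lastCases ?_ (fun i => ?_) i
        · simp
        · refine Fin.lastCases ?_ (fun i => ?_) i <;> simp
      rw [e1, e2, comb_assoc]
      · have e3 : c / (1 - a) / (c / (1 - a) + b / (1 - a)) = c / (c + b) := by field_simp
        have e4 : b / (1 - a) / (c / (1 - a) + b / (1 - a)) = b / (c + b) := by field_simp
        rw [e3, e4]
      · constructor
        · intro i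
          refine Fin.lastCases ?_ (fun i => ?_) i
          · simpa using div_pos hb h1a
          · refine Fin.lastCases ?_ (fun i => ?_) i
            · simpa using div_pos hc h1a
            · simpa using div_pos (hpw i) h1a
        · simp only [Fin.sum_univ_castSucc (n := n + 1), Fin.sum_univ_castSucc (n := n),
            Fin.snoc_castSucc, Fin.snoc_last, ← Finset.sum_div]
          rw [← add_div, ← add_div, div_eq_one_iff_eq h1a.ne']
          linarith
    · constructor
      · intro i
        refine Fin.cases ?_ (fun i => ?_) i
        · simpa using ha
        · refine Fin.lastCases ?_ (fun i => ?_) i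
          · simpa using add_pos hc hb
          · simpa using hpw i
      · rw [Fin.sum_univ_succ]
        simp only [Fin.cons_zero, Fin.cons_succ, Fin.sum_univ_castSucc (n := n),
          Fin.snoc_castSucc, Fin.snoc_last]
        linarith

theorem comb_four (a b c d : ℝ) (p q r s : 𝔛) (ha : 0 < a) (hb : 0 < b) (hc : 0 < c) (hd : 0 < d)
    (h : a + b + c + d = 1) :
    comb ![a, b, c, d] ![p, q, r, s] = comb ![a + b, 1 - (a + b)]
      ![comb ![a / (a + b), b / (a + b)] ![p, q], comb ![c / (c + d), d / (c + d)] ![r, s]] := by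
  have hw : IsWeight ![a, b, c, d] := by
    constructor
    · intro i; fin_cases i <;> simpa
    · simp [Fin.sum_univ_succ]; linarith
  have e1 : ![a, b, c, d] = (Fin.snoc (Fin.snoc ![a, b] c : Fin 3 → ℝ) d : Fin 4 → ℝ) := by
    ext i; fin_cases i <;> rfl
  have e2 : ![p, q, r, s] = (Fin.snoc (Fin.snoc ![p, q] r : Fin 3 → 𝔛) s : Fin 4 → 𝔛) := by
    ext i; fin_cases i <;> rfl
  rw [e1, e2, comb_assoc _ _ _ _ _ _ (e1 ▸ hw)]
  set R := comb ![c / (c + d), d / (c + d)] ![r, s]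
  have hw3 : IsWeight (Fin.snoc ![a, b] (c + d) : Fin 3 → ℝ) := by
    constructor
    · intro i; fin_cases i
      · exact ha
      · exact hb
      · exact add_pos hc hd
    · have : (Fin.snoc ![a, b] (c + d) : Fin 3 → ℝ) = ![a, b, c + d] := by
        ext i; fin_cases i <;> rfl
      rw [this]; simp [Fin.sum_univ_succ]; linarith
  have hw3' : IsWeight (Fin.cons (c + d) ![a, b] : Fin 3 → ℝ) := by
    constructor
    · intro i; fin_cases i
      · exact add_pos hc hd
      · exact ha
      · exact hb
    · simp [Fin.sum_univ_succ]; linarith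
  rw [comb_perm _ _ (finRotate 3).symm hw3]
  have e3 : (Fin.snoc ![a, b] (c + d) : Fin 3 → ℝ) ∘ (finRotate 3).symm =
      (Fin.cons (c + d) ![a, b] : Fin 3 → ℝ) := by
    ext i; fin_cases i <;> rfl
  have e4 : (Fin.snoc ![p, q] R : Fin 3 → 𝔛) ∘ (finRotate 3).symm =
      (Fin.cons R ![p, q] : Fin 3 → 𝔛) := by
    ext i; fin_cases i <;> rfl
  rw [e3, e4, comb_cons _ _ _ _ hw3']
  have hab : 1 - (c + d) = a + b := by linarith
  have hcd : 1 - (a + b) = c + d := by linarith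
  rw [hab, hcd]
  have hw2 : IsWeight ![c + d, a + b] := by
    constructor
    · intro i; fin_cases i
      · exact add_pos hc hd
      · exact add_pos ha hb
    · simp [Fin.sum_univ_succ]; linarith
  have e5 : (fun i => ![a, b] i / (a + b)) = ![a / (a + b), b / (a + b)] := by
    ext i; fin_cases i <;> rfl
  rw [e5, comb_perm _ _ (Equiv.swap 0 1) hw2]
  congr 1 <;> (ext i; fin_cases i <;> simp)

theorem comb_interchange (a l : ℝ) (ha : a ∈ Set.Ioo (0 : ℝ) 1) (hl : l ∈ Set.Ioo (0 : ℝ) 1)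
    (p q r s : 𝔛) :
    comb ![a, 1 - a] ![comb ![l, 1 - l] ![p, q], comb ![l, 1 - l] ![r, s]] =
      comb ![l, 1 - l] ![comb ![a, 1 - a] ![p, r], comb ![a, 1 - a] ![q, s]] := by
  obtain ⟨ha0, ha1⟩ := ha
  obtain ⟨hl0, hl1⟩ := hl
  have ha1' : 0 < 1 - a := by linarith
  have hl1' : 0 < 1 - l := by linarith
  have h1 := comb_four (a * l) (a * (1 - l)) ((1 - a) * l) ((1 - a) * (1 - l)) p q r s
    (by positivity) (by positivity) (by positivity) (by positivity) (by ring)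
  have h2 := comb_four (a * l) ((1 - a) * l) (a * (1 - l)) ((1 - a) * (1 - l)) p r q s
    (by positivity) (by positivity) (by positivity) (by positivity) (by ring)
  have hw : IsWeight ![a * l, a * (1 - l), (1 - a) * l, (1 - a) * (1 - l)] := by
    constructor
    · intro i; fin_cases i
      exacts [mul_pos ha0 hl0, mul_pos ha0 hl1', mul_pos ha1' hl0, mul_pos ha1' hl1']
    · simp [Fin.sum_univ_succ]; ring
  have h3 := comb_perm _ ![p, q, r, s] (Equiv.swap 1 2) hw
  have e1 : ![a * l, a * (1 - l), (1 - a) * l, (1 - a) * (1 - l)] ∘ (Equiv.swap 1 2) =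
      ![a * l, (1 - a) * l, a * (1 - l), (1 - a) * (1 - l)] := by
    ext i; fin_cases i <;> rfl
  have e2 : ![p, q, r, s] ∘ (Equiv.swap 1 2) = ![p, r, q, s] := by
    ext i; fin_cases i <;> rfl
  rw [e1, e2, h1, h2] at h3
  have s1 : a * l + a * (1 - l) = a := by ring
  have s2 : (1 - a) * l + (1 - a) * (1 - l) = 1 - a := by ring
  have s3 : a * l + (1 - a) * l = l := by ring
  have s4 : a * (1 - l) + (1 - a) * (1 - l) = 1 - l := by ring
  rw [s1, s2, s3, s4, mul_div_cancel_left₀ _ ha0.ne', mul_div_cancel_left₀ _ ha0.ne',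
    mul_div_cancel_left₀ _ ha1'.ne', mul_div_cancel_left₀ _ ha1'.ne',
    mul_div_cancel_right₀ _ hl0.ne', mul_div_cancel_right₀ _ hl0.ne',
    mul_div_cancel_right₀ _ hl1'.ne', mul_div_cancel_right₀ _ hl1'.ne'] at h3
  exact h3

theorem mean_comb (l : ℝ) (hl : l ∈ Set.Ioo (0 : ℝ) 1) (x y : 𝔛) (n : ℕ) :
    comb (fun _ : Fin (n + 1) => ((n : ℝ) + 1)⁻¹) (fun _ => comb ![l, 1 - l] ![x, y]) =
      comb ![l, 1 - l] ![comb (fun _ : Fin (n + 1) => ((n : ℝ) + 1)⁻¹) (fun _ => x),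
        comb (fun _ : Fin (n + 1) => ((n : ℝ) + 1)⁻¹) (fun _ => y)] := by
  induction n with
  | zero =>
    have h : ∀ z : 𝔛, comb (fun _ : Fin (0 + 1) => (((0 : ℕ) : ℝ) + 1)⁻¹) (fun _ => z) = z := by
      intro z
      conv_rhs => rw [← comb_one z]
      congr 1
      · ext i; fin_cases i; simp
      · ext i; fin_cases i; rfl
    simp only [h]
  | succ n ih =>
    have hn : (0 : ℝ) < (n : ℝ) + 1 := by positivity
    have key : ∀ z : 𝔛,
        comb (fun _ : Fin (n + 1 + 1) => (((n + 1 : ℕ) : ℝ) + 1)⁻¹) (fun _ => z) =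
        comb ![(((n + 1 : ℕ) : ℝ) + 1)⁻¹, 1 - (((n + 1 : ℕ) : ℝ) + 1)⁻¹]
          ![z, comb (fun _ : Fin (n + 1) => ((n : ℝ) + 1)⁻¹) (fun _ => z)] := by
      intro z
      have e1 : (fun _ : Fin (n + 1 + 1) => (((n + 1 : ℕ) : ℝ) + 1)⁻¹) =
          (Fin.cons ((((n + 1 : ℕ) : ℝ) + 1)⁻¹) (fun _ => (((n + 1 : ℕ) : ℝ) + 1)⁻¹) :
            Fin (n + 2) → ℝ) := by
        ext i; refine Fin.cases ?_ (fun i => ?_) i <;> simp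
      have e2 : (fun _ : Fin (n + 1 + 1) => z) =
          (Fin.cons z (fun _ => z) : Fin (n + 2) → 𝔛) := by
        ext i; refine Fin.cases ?_ (fun i => ?_) i <;> simp
      have hw : IsWeight (Fin.cons ((((n + 1 : ℕ) : ℝ) + 1)⁻¹)
          (fun _ => (((n + 1 : ℕ) : ℝ) + 1)⁻¹) : Fin (n + 2) → ℝ) := by
        rw [← e1]
        constructor
        · intro i; positivity
        · simp; field_simp
      have e3 : (fun _ : Fin (n + 1) => (((n + 1 : ℕ) : ℝ) + 1)⁻¹ /
          (1 - (((n + 1 : ℕ) : ℝ) + 1)⁻¹)) = fun _ => ((n : ℝ) + 1)⁻¹ := by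
        ext i
        have : (1 - (((n + 1 : ℕ) : ℝ) + 1)⁻¹) = ((n : ℝ) + 1) * (((n + 1 : ℕ) : ℝ) + 1)⁻¹ := by
          push_cast; field_simp; ring
        rw [this]; push_cast; field_simp
      rw [e1, e2, comb_cons _ _ _ _ hw, e3]
    have hmem : (((n + 1 : ℕ) : ℝ) + 1)⁻¹ ∈ Set.Ioo (0 : ℝ) 1 := by
      constructor
      · positivity
      · apply inv_lt_one_of_one_lt₀; push_cast; linarith
    rw [key, key, key, ih, comb_interchange _ _ hmem hl]

theorem convexify_comb_two (l : ℝ) (hl : l ∈ Set.Ioo (0 : ℝ) 1) (x y : 𝔛) :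
    convexify (comb ![l, 1 - l] ![x, y]) = comb ![l, 1 - l] ![convexify x, convexify y] := by
  refine tendsto_nhds_unique (tendsto_convexify _) ?_
  simp only [mean_comb l hl]
  rw [tendsto_iff_dist_tendsto_zero]
  have h0 := ((tendsto_iff_dist_tendsto_zero.1 (tendsto_convexify x)).const_mul l).add
    ((tendsto_iff_dist_tendsto_zero.1 (tendsto_convexify y)).const_mul (1 - l))
  simp only [mul_zero, add_zero] at h0
  exact squeeze_zero (fun _ => dist_nonneg) (fun _ => dist_comb_le _ _ _ _ l hl) h0

theorem comb_mem_convexDomain {n : ℕ} : ∀ (w : Fin n → ℝ) (u : Fin n → 𝔛), IsWeight w →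
    (∀ i, u i ∈ convexDomain 𝔛) → comb w u ∈ convexDomain 𝔛 := by
  match n with
  | 0 => intro w u hw; exact absurd hw.sum_eq_one (by simp)
  | n + 1 =>
    induction n with
    | zero =>
      intro w u hw hu
      have e1 : w = ![1] := by
        ext i; fin_cases i; simpa using hw.sum_eq_one
      have e2 : u = ![u 0] := by ext i; fin_cases i; rfl
      rw [e1, e2, comb_one]; exact hu 0
    | succ n ih =>
      intro w u hw hu
      obtain ⟨a, w, rfl⟩ : ∃ (a : ℝ) (w' : Fin (n + 1) → ℝ), w = Fin.cons a w' :=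
        ⟨w 0, Fin.tail w, (Fin.cons_self_tail w).symm⟩
      obtain ⟨x, u, rfl⟩ : ∃ (a : 𝔛) (w' : Fin (n + 1) → 𝔛), u = Fin.cons a w' :=
        ⟨u 0, Fin.tail u, (Fin.cons_self_tail u).symm⟩
      have ha : 0 < a := by simpa using hw.pos 0
      have hpw : ∀ i, 0 < w i := fun i => by simpa using hw.pos i.succ
      have hs := hw.sum_eq_one
      rw [Fin.sum_univ_succ] at hs
      simp only [Fin.cons_zero, Fin.cons_succ] at hs
      have hsw : 0 < ∑ i, w i :=
        Finset.sum_pos (fun i _ => hpw i) Finset.univ_nonempty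
      have h1a : 0 < 1 - a := by linarith
      rw [comb_cons _ _ _ _ hw]
      obtain ⟨y, hy⟩ := ih (fun i => w i / (1 - a)) u
        ⟨fun i => div_pos (hpw i) h1a, by
          rw [← Finset.sum_div, div_eq_one_iff_eq h1a.ne']; linarith⟩
        (fun i => by simpa using hu i.succ)
      obtain ⟨z, hz⟩ : x ∈ convexDomain 𝔛 := by simpa using hu 0
      rw [← hy, ← hz, ← convexify_comb_two a ⟨ha, by linarith⟩]
      exact ⟨_, rfl⟩

open Classical in
/-- The convex combination of points of `K(𝔛)`, formed in `𝔛`. -/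
noncomputable def domainComb {n : ℕ} (w : Fin n → ℝ) (u : Fin n → convexDomain 𝔛) :
    convexDomain 𝔛 :=
  if hw : IsWeight w then
    ⟨comb w (fun i => (u i : 𝔛)), comb_mem_convexDomain _ _ hw fun i => (u i).2⟩
  else toDomain (comb w fun i => (u i : 𝔛))

theorem coe_domainComb {n : ℕ} {w : Fin n → ℝ} (hw : IsWeight w) (u : Fin n → convexDomain 𝔛) :
    (domainComb w u : 𝔛) = comb w (fun i => (u i : 𝔛)) := by
  rw [domainComb, dif_pos hw]

theorem isWeight_two {l : ℝ} (hl : l ∈ Set.Ioo (0 : ℝ) 1) : IsWeight ![l, 1 - l] := by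
  obtain ⟨h0, h1⟩ := hl
  constructor
  · intro i; fin_cases i
    · exact h0
    · simpa using h1
  · simp [Fin.sum_univ_succ]

theorem coe_domainComb_two {l : ℝ} (hl : l ∈ Set.Ioo (0 : ℝ) 1) (x y : convexDomain 𝔛) :
    (domainComb ![l, 1 - l] ![x, y] : 𝔛) = comb ![l, 1 - l] ![(x : 𝔛), (y : 𝔛)] := by
  rw [coe_domainComb (isWeight_two hl)]
  congr 1
  ext i; fin_cases i <;> rfl

/-- `K(𝔛)`, with the metric and the convex combinations of `𝔛`, is a convex combination space. -/
noncomputable instance instConvexDomain : ConvexCombSpace (convexDomain 𝔛) where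
  comb := domainComb
  comb_one u := by
    apply Subtype.ext
    rw [coe_domainComb ⟨fun i => by fin_cases i; simp, by simp⟩]
    conv_rhs => rw [← comb_one (u : 𝔛)]
    congr 1
    ext i; fin_cases i; rfl
  comb_perm w u σ hw := by
    apply Subtype.ext
    rw [coe_domainComb hw, coe_domainComb, comb_perm _ _ σ hw]
    · rfl
    · exact ⟨fun i => hw.pos _, by
        rw [← hw.sum_eq_one]; exact Equiv.sum_comp σ w⟩
  comb_assoc {n} w a b u x y hw := by
    have hs := hw.sum_eq_one
    simp only [Fin.sum_univ_castSucc (n := n + 1), Fin.sum_univ_castSucc (n := n),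
      Fin.snoc_castSucc, Fin.snoc_last] at hs
    have hpw : ∀ i, 0 < w i := fun i => by
      have := hw.pos i.castSucc.castSucc
      simpa only [Fin.snoc_castSucc] using this
    have ha : 0 < a := by
      have := hw.pos (Fin.last n).castSucc
      simpa only [Fin.snoc_castSucc, Fin.snoc_last] using this
    have hb : 0 < b := by
      have := hw.pos (Fin.last (n + 1))
      simpa only [Fin.snoc_last] using this
    have hw' : IsWeight (Fin.snoc w (a + b) : Fin (n + 1) → ℝ) := by
      constructor
      · intro i
        refine Fin.lastCases ?_ (fun i => ?_) i
        · simpa using add_pos ha hb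
        · simpa using hpw i
      · simp only [Fin.sum_univ_castSucc (n := n), Fin.snoc_castSucc, Fin.snoc_last]
        linarith
    have hab : b / (a + b) = 1 - a / (a + b) := by field_simp; ring
    have hl : a / (a + b) ∈ Set.Ioo (0 : ℝ) 1 :=
      ⟨by positivity, by rw [div_lt_one (by positivity)]; linarith⟩
    apply Subtype.ext
    rw [coe_domainComb hw, coe_domainComb hw']
    have e1 : (fun i => ((Fin.snoc (Fin.snoc u x : Fin (n + 1) → convexDomain 𝔛) y :
        Fin (n + 2) → convexDomain 𝔛) i : 𝔛)) =
        (Fin.snoc (Fin.snoc (fun i => (u i : 𝔛)) (x : 𝔛) : Fin (n + 1) → 𝔛) (y : 𝔛) :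
          Fin (n + 2) → 𝔛) := by
      ext i
      refine Fin.lastCases ?_ (fun i => ?_) i
      · simp
      · refine Fin.lastCases ?_ (fun i => ?_) i <;> simp
    have e2 : ∀ z : convexDomain 𝔛, (fun i => ((Fin.snoc u z :
        Fin (n + 1) → convexDomain 𝔛) i : 𝔛)) =
        (Fin.snoc (fun i => (u i : 𝔛)) (z : 𝔛) : Fin (n + 1) → 𝔛) := by
      intro z
      ext i
      refine Fin.lastCases ?_ (fun i => ?_) i <;> simp
    rw [e1, e2, comb_assoc _ _ _ _ _ _ hw, hab, coe_domainComb_two hl]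
  comb_continuous u v l l₀ hl hl₀ h := by
    rw [tendsto_subtype_rng]
    simp only [coe_domainComb_two hl₀, coe_domainComb_two (hl _)]
    exact comb_continuous _ _ _ _ hl hl₀ h
  dist_comb_le u₁ u₂ v₁ v₂ l hl := by
    rw [Subtype.dist_eq, coe_domainComb_two hl, coe_domainComb_two hl]
    exact dist_comb_le _ _ _ _ l hl
  exists_convexification u := by
    refine ⟨toDomain (u : 𝔛), ?_⟩
    rw [tendsto_subtype_rng]
    refine (tendsto_convexify (u : 𝔛)).congr fun n => ?_
    rw [coe_domainComb]
    exact ⟨fun i => by positivity, by simp; field_simp⟩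

end Domain

section Expectation

variable {Ω 𝔛 : Type*} [MeasurableSpace Ω] [MetricSpace 𝔛] [ConvexCombSpace 𝔛]

/-- The convex combination `[w i, x i]_{i ∈ s}` over a finite index set (the order in which the
indices are listed is irrelevant, by commutativity). -/
noncomputable def finsetComb {ι : Type*} (s : Finset ι) (w : ι → ℝ) (x : ι → 𝔛) : 𝔛 :=
  comb (fun i : Fin s.card => w (s.equivFin.symm i)) (fun i => x (s.equivFin.symm i))

open Classical in
/-- The expectation `[P(X = x), K x]` of a simple random element, where `x` runs through the
finitely many values of `X`, values of probability zero being left out. -/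
noncomputable def simpleExpectation (P : Measure Ω) (X : SimpleFunc Ω 𝔛) : 𝔛 :=
  finsetComb (X.range.filter fun x => 0 < P.real (X ⁻¹' {x})) (fun x => P.real (X ⁻¹' {x}))
    convexify

/-- The sequence `u` consists of a point `u 0` of `K(𝔛)` followed by an enumeration `u 1, u 2, …`
of a countable dense subset of `𝔛`. -/
structure IsApproxSeq (u : ℕ → 𝔛) : Prop where
  zero_mem : u 0 ∈ convexDomain 𝔛
  dense : DenseRange fun j => u (j + 1)

variable [MeasurableSpace 𝔛]

/-- Integrable random elements. -/
structure IsIntegrableElement (P : Measure Ω) (X : Ω → 𝔛) : Prop where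
  measurable : Measurable X
  integrable : ∃ a : 𝔛, Integrable (fun ω => dist a (X ω)) P

variable [OpensMeasurableSpace 𝔛]

/-- The expectations `E ψ_n(X)` of the simple approximations of `X`: here `ψ_n(x)` is the point
among `u 0, …, u n` which is nearest to `x`, the one of least index in case of ties. -/
noncomputable def approxExpectation (u : ℕ → 𝔛) (P : Measure Ω) (X : Ω → 𝔛) (hX : Measurable X)
    (n : ℕ) : 𝔛 :=
  simpleExpectation P ((SimpleFunc.nearestPt u n).comp X hX)

/-- The expectation `EX = lim E ψ_n(X)`. -/
noncomputable def expectation (u : ℕ → 𝔛) (P : Measure Ω) (X : Ω → 𝔛) (hX : Measurable X) : 𝔛 :=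
  haveI : Nonempty 𝔛 := ⟨u 0⟩
  limUnder atTop (approxExpectation u P X hX)

end Expectation

section Embedding

variable {Y : Type*} [MetricSpace Y] [ConvexCombSpace Y]
  {E : Type*} [NormedAddCommGroup E] [NormedSpace ℝ E]

/-- `j` embeds the convex combination space `Y` affinely and isometrically as a closed convex
subset of `E`.  (For weights `l = 0` and `l = 1`, where `[0, x; 1, y] = y` and `[1, x; 0, y] = x` by
convention, the identity `map_comb` is trivial.) -/
structure IsAffineEmbedding (j : Y → E) : Prop where
  isClosed_range : IsClosed (Set.range j)
  convex_range : Convex ℝ (Set.range j)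
  map_comb : ∀ (x y : Y) (l : ℝ), l ∈ Set.Ioo (0 : ℝ) 1 →
    j (comb ![l, 1 - l] ![x, y]) = l • j x + (1 - l) • j y
  dist_eq : ∀ x y : Y, dist x y = ‖j x - j y‖

end Embedding

end ConvexCombSpace

open ConvexCombSpace
universe u₁ u₂ u₃

/-! On `K(𝔛)` the convex combinations are idempotent: `[l, Ku; 1 - l, Ku] = Ku`. For rational `l`
this comes from pooling two blocks of copies of `u` in proportion `l : 1 - l` and letting the blocks
grow; continuity in the weight gives all `l` (`mix_convexify`). Hence `K` is a nonexpansive affine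
retraction onto `K(𝔛)`, which is its fixed-point set, closed and therefore complete.

An idempotent space `Y` generates a cone of formal multiples `r • x`, a semimodule over the
nonnegative reals, with distance `r * d(x, y)` between elements of equal mass `r`. The decisive fact
is that adding `c` preserves this distance (`Cone.sliceDist_add_right`). Axiom (iv) gives `≤`.
Conversely, exchanging `n` copies of `a` for `b` one by one gives `D(n a + c, n b + c) ≤ n D(a + c,
b + c)`; division by `n` and `n → ∞` yield `D(a, b) ≤ D(a + c, b + c)`. Multiples of a base point
`o` equalise different masses, so the distance between the positive and negative parts of a formal
real combination is a seminorm, and the completion is the Banach space sought.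

For the expectations, let `j` be any embedding. The map `j ∘ K` is affine, nonexpansive and does not
distinguish `x` from `Kx`, so it sends the expectation of a simple element to a Bochner integral.
Dominated convergence along `ψ_n(X)` identifies the limit with `E j(KX)`; it stays in the closed
range of `j`, and since `j` is an isometry the expectations themselves converge. The limit is
determined by its image under `j`, hence does not depend on the approximating sequence. -/

namespace ConvexCombSpace

/-! ### Idempotence of convex combinations on the convexifiable domain -/

section Idempotence

variable {𝔛 : Type*} [MetricSpace 𝔛] [ConvexCombSpace 𝔛]

/-- The binary convex combination `[l, x; 1 - l, y]`. -/
def mix (l : ℝ) (x y : 𝔛) : 𝔛 := comb ![l, 1 - l] ![x, y]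

/-- The mean `[n⁻¹, u]_{i=1}^n` of `n` copies of `u`, indexed by `n - 1`. -/
noncomputable def selfMean (n : ℕ) (u : 𝔛) : 𝔛 :=
  comb (fun _ : Fin (n + 1) => ((n : ℝ) + 1)⁻¹) (fun _ => u)

theorem mix_comm {l : ℝ} (hl : l ∈ Set.Ioo (0 : ℝ) 1) (x y : 𝔛) :
    mix l x y = mix (1 - l) y x := by
  rw [mix, mix, comb_perm _ _ (Equiv.swap 0 1) (isWeight_two hl)]
  congr 1 <;> (ext i; fin_cases i <;> simp)

/-- Both sides compute the ternary combination `[a, x; b, y; c, z]`: one splits off `x`, the other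
splits off `z` after a cyclic rotation. -/
theorem mix_assoc {a b c : ℝ} (ha : 0 < a) (hb : 0 < b) (hc : 0 < c) (h : a + b + c = 1)
    (x y z : 𝔛) :
    mix a x (mix (b / (b + c)) y z) = mix (a + b) (mix (a / (a + b)) x y) z := by
  have hw : IsWeight (Fin.cons a ![b, c] : Fin 3 → ℝ) := by
    constructor
    · intro i; fin_cases i
      exacts [ha, hb, hc]
    · simp [Fin.sum_univ_succ]; linarith
  have hw' : IsWeight (Fin.cons c ![a, b] : Fin 3 → ℝ) := by
    constructor
    · intro i; fin_cases i
      exacts [hc, ha, hb]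
    · simp [Fin.sum_univ_succ]; linarith
  have h1 := comb_cons a ![b, c] x ![y, z] hw
  have h2 := comb_cons c ![a, b] z ![x, y] hw'
  have h3 := comb_perm _ (Fin.cons x ![y, z] : Fin 3 → 𝔛) (finRotate 3).symm hw
  have e3 : (Fin.cons a ![b, c] : Fin 3 → ℝ) ∘ (finRotate 3).symm =
      (Fin.cons c ![a, b] : Fin 3 → ℝ) := by
    ext i; fin_cases i <;> rfl
  have e4 : (Fin.cons x ![y, z] : Fin 3 → 𝔛) ∘ (finRotate 3).symm =
      (Fin.cons z ![x, y] : Fin 3 → 𝔛) := by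
    ext i; fin_cases i <;> rfl
  rw [e3, e4, h1, h2] at h3
  have e5 : (fun i => ![b, c] i / (1 - a)) = ![b / (b + c), 1 - b / (b + c)] := by
    have : 1 - a = b + c := by linarith
    rw [this]
    ext i; fin_cases i
    · rfl
    · simp; field_simp; ring
  have e6 : (fun i => ![a, b] i / (1 - c)) = ![a / (a + b), 1 - a / (a + b)] := by
    have : 1 - c = a + b := by linarith
    rw [this]
    ext i; fin_cases i
    · rfl
    · simp; field_simp; ring
  rw [e5, e6] at h3
  have hab : a + b = 1 - c := by linarith
  refine h3.trans ?_
  change mix c z (mix _ x y) = _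
  rw [mix_comm ⟨hc, by linarith⟩, ← hab]

theorem dist_mix_le {l : ℝ} (hl : l ∈ Set.Ioo (0 : ℝ) 1) (x₁ x₂ y₁ y₂ : 𝔛) :
    dist (mix l x₁ x₂) (mix l y₁ y₂) ≤ l * dist x₁ y₁ + (1 - l) * dist x₂ y₂ :=
  dist_comb_le _ _ _ _ l hl

theorem tendsto_mix {l : ℝ} (hl : l ∈ Set.Ioo (0 : ℝ) 1) {ι : Type*} {F : Filter ι}
    {x y : ι → 𝔛} {x₀ y₀ : 𝔛} (hx : Tendsto x F (𝓝 x₀)) (hy : Tendsto y F (𝓝 y₀)) :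
    Tendsto (fun i => mix l (x i) (y i)) F (𝓝 (mix l x₀ y₀)) := by
  rw [tendsto_iff_dist_tendsto_zero] at *
  have h0 := (hx.const_mul l).add (hy.const_mul (1 - l))
  simp only [mul_zero, add_zero] at h0
  exact squeeze_zero (fun _ => dist_nonneg) (fun _ => dist_mix_le hl _ _ _ _) h0

theorem selfMean_zero (u : 𝔛) : selfMean 0 u = u := by
  conv_rhs => rw [← comb_one u]
  rw [selfMean]
  congr 1
  · ext i; fin_cases i; simp
  · ext i; fin_cases i; rfl

theorem inv_mem_Ioo (n : ℕ) : ((n : ℝ) + 2)⁻¹ ∈ Set.Ioo (0 : ℝ) 1 :=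
  ⟨by positivity, inv_lt_one_of_one_lt₀ (by have := n.cast_nonneg (α := ℝ); linarith)⟩

theorem selfMean_succ (n : ℕ) (u : 𝔛) :
    selfMean (n + 1) u = mix ((n : ℝ) + 2)⁻¹ u (selfMean n u) := by
  have hn : (0 : ℝ) < (n : ℝ) + 1 := by positivity
  have h2 : (((n + 1 : ℕ) : ℝ) + 1)⁻¹ = ((n : ℝ) + 2)⁻¹ := by push_cast; ring
  have e1 : (fun _ : Fin (n + 1 + 1) => (((n + 1 : ℕ) : ℝ) + 1)⁻¹) =
      (Fin.cons (((n : ℝ) + 2)⁻¹) (fun _ => ((n : ℝ) + 2)⁻¹) : Fin (n + 2) → ℝ) := by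
    ext i; rw [h2]; refine Fin.cases ?_ (fun i => ?_) i <;> simp
  have e2 : (fun _ : Fin (n + 1 + 1) => u) = (Fin.cons u (fun _ => u) : Fin (n + 2) → 𝔛) := by
    ext i; refine Fin.cases ?_ (fun i => ?_) i <;> simp
  have hw : IsWeight (Fin.cons (((n : ℝ) + 2)⁻¹) (fun _ => ((n : ℝ) + 2)⁻¹) :
      Fin (n + 2) → ℝ) := by
    rw [← e1]
    constructor
    · intro i; positivity
    · simp; field_simp
  have e3 : (fun _ : Fin (n + 1) => ((n : ℝ) + 2)⁻¹ / (1 - ((n : ℝ) + 2)⁻¹)) =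
      fun _ => ((n : ℝ) + 1)⁻¹ := by
    ext i
    have : 1 - ((n : ℝ) + 2)⁻¹ = ((n : ℝ) + 1) * ((n : ℝ) + 2)⁻¹ := by field_simp; ring
    rw [this]; field_simp
  rw [selfMean, e1, e2, comb_cons _ _ _ _ hw, e3]
  rfl

/-- The weight is the share of the first block among all copies of `u`, since `selfMean p` averages
`p + 1` of them. Copies move from the first block to the second one at a time, by `mix_assoc`. -/
theorem mix_selfMean (p q : ℕ) (u : 𝔛) :
    mix (((p : ℝ) + 1) / (p + q + 2)) (selfMean p u) (selfMean q u) = selfMean (p + q + 1) u := by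
  induction p with
  | zero =>
    rw [selfMean_zero, zero_add, selfMean_succ]
    congr 1
    simp
  | succ p ih =>
    -- The three blocks contain `1`, `p + 1` and `q + 1` copies of `u`, out of `p + q + 3`.
    have h := mix_assoc (a := ((p : ℝ) + q + 3)⁻¹) (b := ((p : ℝ) + 1) * (p + q + 3 : ℝ)⁻¹)
      (c := ((q : ℝ) + 1) * (p + q + 3 : ℝ)⁻¹) (by positivity) (by positivity) (by positivity)
      (by field_simp; ring) u (selfMean p u) (selfMean q u)
    have e1 : ((p : ℝ) + 1) * (p + q + 3 : ℝ)⁻¹ / (((p : ℝ) + 1) * (p + q + 3 : ℝ)⁻¹ +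
        ((q : ℝ) + 1) * (p + q + 3 : ℝ)⁻¹) = ((p : ℝ) + 1) / (p + q + 2) := by
      rw [← add_mul, mul_div_mul_right _ _ (by positivity)]
      congr 1; ring
    have e2 : ((p : ℝ) + q + 3)⁻¹ / (((p : ℝ) + q + 3)⁻¹ + ((p : ℝ) + 1) * (p + q + 3 : ℝ)⁻¹) =
        ((p : ℝ) + 2)⁻¹ := by
      field_simp; ring
    have e3 : ((p : ℝ) + q + 3)⁻¹ + ((p : ℝ) + 1) * (p + q + 3 : ℝ)⁻¹ =
        (((p + 1 : ℕ) : ℝ) + 1) / ((p + 1 : ℕ) + q + 2) := by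
      push_cast; field_simp; ring
    rw [e1, e2, e3, ih, ← selfMean_succ] at h
    rw [← h, show p + 1 + q + 1 = (p + q + 1) + 1 by ring, selfMean_succ (p + q + 1)]
    congr 1
    push_cast; ring

/-- Enlarging both blocks by the same factor `k + 1` leaves the weight in `mix_selfMean` unchanged,
while all three means tend to `convexify u`. -/
theorem mix_convexify_of_nat (p q : ℕ) (u : 𝔛) :
    mix (((p : ℝ) + 1) / (p + q + 2)) (convexify u) (convexify u) = convexify u := by
  have hl : ((p : ℝ) + 1) / (p + q + 2) ∈ Set.Ioo (0 : ℝ) 1 :=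
    ⟨by positivity, by
      rw [div_lt_one (by positivity)]; have := q.cast_nonneg (α := ℝ); linarith⟩
  -- A mean of `(k + 1) * (r + 1)` copies has index one less.
  have ht : ∀ r : ℕ, Tendsto (fun k : ℕ => (k + 1) * (r + 1) - 1) atTop atTop := fun r =>
    tendsto_atTop_mono (fun k => by
      have : k + 1 ≤ (k + 1) * (r + 1) := Nat.le_mul_of_pos_right _ (by omega)
      show k ≤ _
      omega) tendsto_id
  have hmean : Tendsto (fun n => selfMean n u) atTop (𝓝 (convexify u)) := tendsto_convexify u
  refine tendsto_nhds_unique (tendsto_mix hl (hmean.comp (ht p)) (hmean.comp (ht q))) ?_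
  refine (hmean.comp (ht (p + q + 1))).congr fun k => ?_
  have hp : 1 ≤ (k + 1) * (p + 1) := Nat.one_le_iff_ne_zero.2 (by positivity)
  have hq : 1 ≤ (k + 1) * (q + 1) := Nat.one_le_iff_ne_zero.2 (by positivity)
  have h := mix_selfMean ((k + 1) * (p + 1) - 1) ((k + 1) * (q + 1) - 1) u
  simp only [Function.comp]
  have e : (k + 1) * (p + 1) - 1 + ((k + 1) * (q + 1) - 1) + 1 = (k + 1) * (p + q + 1 + 1) - 1 := by
    have : (k + 1) * (p + q + 1 + 1) = (k + 1) * (p + 1) + (k + 1) * (q + 1) := by ring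
    omega
  rw [e] at h
  rw [← h]
  congr 1
  push_cast [Nat.cast_sub hp, Nat.cast_sub hq]
  rw [← mul_div_mul_left ((p : ℝ) + 1) _ (by positivity : (k : ℝ) + 1 ≠ 0)]
  congr 1 <;> ring

theorem mix_convexify {l : ℝ} (hl : l ∈ Set.Ioo (0 : ℝ) 1) (u : 𝔛) :
    mix l (convexify u) (convexify u) = convexify u := by
  have hrat : ∀ r : ℚ, (r : ℝ) ∈ Set.Ioo (0 : ℝ) 1 →
      mix (r : ℝ) (convexify u) (convexify u) = convexify u := by
    rintro r ⟨h0, h1⟩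
    have h0' : 0 < r.num := Rat.num_pos.2 (by exact_mod_cast h0)
    have h1' : r.num < r.den := Rat.num_lt_denom_iff.2 (by exact_mod_cast h1)
    obtain ⟨p, hp⟩ : ∃ p : ℕ, r.num = p + 1 := ⟨(r.num - 1).toNat, by omega⟩
    obtain ⟨q, hq⟩ : ∃ q : ℕ, (r.den : ℤ) = p + q + 2 := ⟨(r.den - p - 2 : ℤ).toNat, by omega⟩
    have hr : (r : ℝ) = ((p : ℝ) + 1) / (p + q + 2) := by
      rw [Rat.cast_def, hp]
      have : (r.den : ℝ) = p + q + 2 := by exact_mod_cast hq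
      rw [this]; push_cast; rfl
    rw [hr, mix_convexify_of_nat]
  obtain ⟨r, -, hr, hrl⟩ := Real.exists_seq_rat_strictMono_tendsto l
  have hev : ∀ᶠ k in atTop, (r k : ℝ) ∈ Set.Ioo (0 : ℝ) 1 := hrl (Ioo_mem_nhds hl.1 hl.2)
  obtain ⟨N, hN⟩ := eventually_atTop.1 hev
  -- The continuity axiom asks that every weight lie in `(0, 1)`, hence the shift by `N`.
  have h := comb_continuous (convexify u) (convexify u) (fun k => (r (k + N) : ℝ)) l
    (fun k => hN _ (by omega)) hl (hrl.comp (tendsto_add_atTop_nat N))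
  refine tendsto_nhds_unique h ?_
  refine tendsto_const_nhds.congr fun k => (hrat _ (hN _ (by omega))).symm

theorem selfMean_convexify (n : ℕ) (u : 𝔛) : selfMean n (convexify u) = convexify u := by
  induction n with
  | zero => exact selfMean_zero _
  | succ n ih => rw [selfMean_succ, ih, mix_convexify (inv_mem_Ioo n)]

theorem convexify_convexify (u : 𝔛) : convexify (convexify u) = convexify u :=
  tendsto_nhds_unique (tendsto_convexify (convexify u))
    (tendsto_const_nhds.congr fun n => (selfMean_convexify n u).symm)

theorem dist_selfMean_le (n : ℕ) (u v : 𝔛) :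
    dist (selfMean n u) (selfMean n v) ≤ dist u v := by
  induction n with
  | zero => rw [selfMean_zero, selfMean_zero]
  | succ n ih =>
    rw [selfMean_succ, selfMean_succ]
    have hl := inv_mem_Ioo n
    refine (dist_mix_le hl _ _ _ _).trans ?_
    have := mul_le_mul_of_nonneg_left ih (sub_nonneg.2 hl.2.le)
    linarith

theorem dist_convexify_le (u v : 𝔛) : dist (convexify u) (convexify v) ≤ dist u v :=
  le_of_tendsto ((tendsto_convexify u).dist (tendsto_convexify v))
    (Eventually.of_forall fun n => dist_selfMean_le n u v)

theorem continuous_convexify : Continuous (convexify : 𝔛 → 𝔛) :=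
  (LipschitzWith.of_dist_le_mul (K := 1) fun u v => by
    simpa using dist_convexify_le u v).continuous

/-- As the fixed-point set of a continuous map, `K(𝔛)` is closed, so it inherits completeness. -/
theorem mem_convexDomain_iff {x : 𝔛} : x ∈ convexDomain 𝔛 ↔ convexify x = x :=
  ⟨by rintro ⟨u, rfl⟩; exact convexify_convexify u, fun h => ⟨x, h⟩⟩

theorem isClosed_convexDomain : IsClosed (convexDomain 𝔛) := by
  have : convexDomain 𝔛 = {x | convexify x = x} := Set.ext fun _ => mem_convexDomain_iff
  rw [this]
  exact isClosed_eq continuous_convexify continuous_id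

theorem toDomain_coe (x : convexDomain 𝔛) : toDomain (x : 𝔛) = x :=
  Subtype.ext (mem_convexDomain_iff.1 x.2)

theorem dist_toDomain_le (u v : 𝔛) : dist (toDomain u) (toDomain v) ≤ dist u v :=
  dist_convexify_le u v

theorem continuous_toDomain : Continuous (toDomain : 𝔛 → convexDomain 𝔛) :=
  continuous_convexify.subtype_mk _

theorem toDomain_comb_two {l : ℝ} (hl : l ∈ Set.Ioo (0 : ℝ) 1) (x y : 𝔛) :
    toDomain (comb ![l, 1 - l] ![x, y]) = comb ![l, 1 - l] ![toDomain x, toDomain y] :=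
  Subtype.ext ((convexify_comb_two l hl x y).trans
    (coe_domainComb_two hl (toDomain x) (toDomain y)).symm)

/-- The means are formed in `𝔛`, where `selfMean_convexify` makes them constant. This is what lets
everything proved for `IsConvexified` spaces apply to `K(𝔛)`. -/
theorem convexify_domain (x : convexDomain 𝔛) : convexify x = x := by
  refine tendsto_nhds_unique (tendsto_convexify x) ?_
  have h : ∀ n : ℕ, (comb (fun _ : Fin (n + 1) => ((n : ℝ) + 1)⁻¹) (fun _ => x) :
      convexDomain 𝔛) = x := by
    intro n
    apply Subtype.ext
    refine (coe_domainComb ⟨fun i => by positivity, by simp; field_simp⟩ _).trans ?_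
    obtain ⟨u, hu⟩ := x.2
    rw [← hu]
    exact selfMean_convexify n u
  simp only [h]
  exact tendsto_const_nhds

end Idempotence

/-- Convex combination spaces all of whose points are fixed by the convexification operator. -/
class IsConvexified (Y : Type*) [MetricSpace Y] [ConvexCombSpace Y] : Prop where
  convexify_eq : ∀ y : Y, convexify y = y

instance {𝔛 : Type*} [MetricSpace 𝔛] [ConvexCombSpace 𝔛] : IsConvexified (convexDomain 𝔛) :=
  ⟨convexify_domain⟩

theorem mix_self {Y : Type*} [MetricSpace Y] [ConvexCombSpace Y] [IsConvexified Y]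
    {l : ℝ} (hl : l ∈ Set.Ioo (0 : ℝ) 1) (y : Y) : mix l y y = y := by
  have := mix_convexify hl y
  rwa [IsConvexified.convexify_eq] at this

/-! ### The cone over an idempotent convex combination space -/

open scoped NNReal

/-- The formal multiple `mass • pt` of a point, for a positive real `mass`. -/
@[ext]
structure Ray (Y : Type*) where
  mass : ℝ
  pos : 0 < mass
  pt : Y

/-- The cone over `Y`: the formal multiples of the points of `Y`, and an apex `0`. -/
abbrev Cone (Y : Type*) := WithZero (Ray Y)

section Cone

variable {Y : Type*}

/-- The scaling of the cone. -/
noncomputable instance : SMul ℝ≥0 (Cone Y) where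
  smul t a := if h : 0 < t then
    WithZero.recZeroCoe 0
      (fun a : Ray Y => ((⟨t * a.mass, mul_pos h a.pos, a.pt⟩ : Ray Y) : Cone Y))
      a else 0

theorem Cone.zero_smul' (a : Cone Y) : (0 : ℝ≥0) • a = 0 := dif_neg (lt_irrefl _)

theorem Cone.smul_zero' (t : ℝ≥0) : t • (0 : Cone Y) = 0 := by
  by_cases h : 0 < t
  · exact dif_pos h
  · exact dif_neg h

theorem Cone.smul_coe {t : ℝ≥0} (h : 0 < t) (a : Ray Y) :
    t • (a : Cone Y) = ((⟨t * a.mass, mul_pos h a.pos, a.pt⟩ : Ray Y) : Cone Y) := dif_pos h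

/-- The mass of an element of the cone. -/
noncomputable def Cone.mass (a : Cone Y) : ℝ≥0 :=
  WithZero.recZeroCoe 0 (fun a : Ray Y => ⟨a.mass, a.pos.le⟩) a

theorem Cone.mass_zero : Cone.mass (0 : Cone Y) = 0 := rfl

/-- The point `x`, as an element of mass one of the cone. -/
noncomputable def Cone.of (x : Y) : Cone Y := ((⟨1, one_pos, x⟩ : Ray Y) : Cone Y)

theorem Cone.mass_of (x : Y) : Cone.mass (Cone.of x) = 1 := rfl

theorem Cone.eq_zero_of_mass_eq_zero {a : Cone Y} (h : Cone.mass a = 0) : a = 0 := by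
  cases a using WithZero.recZeroCoe with
  | zero => rfl
  | coe a => exact absurd (congrArg NNReal.toReal h) a.pos.ne'

theorem Cone.mass_smul (t : ℝ≥0) (a : Cone Y) : Cone.mass (t • a) = t * Cone.mass a := by
  rcases eq_zero_or_pos t with rfl | ht
  · simp only [Cone.zero_smul', zero_mul, Cone.mass_zero]
  cases a using WithZero.recZeroCoe with
  | zero => simp only [Cone.smul_zero', mul_zero, Cone.mass_zero]
  | coe a => rw [Cone.smul_coe ht]; rfl

theorem Cone.coe_of_mass_eq {a : Ray Y} {b : Cone Y} (h : Cone.mass (a : Cone Y) = Cone.mass b) :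
    ∃ b' : Ray Y, b = b' ∧ b'.mass = a.mass := by
  cases b using WithZero.recZeroCoe with
  | zero => exact absurd (congrArg NNReal.toReal h) a.pos.ne'
  | coe b => exact ⟨b, rfl, (congrArg NNReal.toReal h).symm⟩

variable [MetricSpace Y]

/-- The distance between two elements of the cone of the same mass, `d(r • x, r • y) = r * d(x, y)`
(for different masses the value is irrelevant). -/
noncomputable def Cone.sliceDist (a b : Cone Y) : ℝ :=
  WithZero.recZeroCoe 0
    (fun a : Ray Y => WithZero.recZeroCoe 0 (fun b : Ray Y => a.mass * dist a.pt b.pt) b) a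

theorem Cone.sliceDist_coe (a b : Ray Y) :
    Cone.sliceDist (a : Cone Y) (b : Cone Y) = a.mass * dist a.pt b.pt := rfl

theorem Cone.sliceDist_nonneg (a b : Cone Y) : 0 ≤ Cone.sliceDist a b := by
  cases a using WithZero.recZeroCoe with
  | zero => exact le_rfl
  | coe a =>
    cases b using WithZero.recZeroCoe with
    | zero => exact le_rfl
    | coe b => exact mul_nonneg a.pos.le dist_nonneg

theorem Cone.sliceDist_self (a : Cone Y) : Cone.sliceDist a a = 0 := by
  cases a using WithZero.recZeroCoe with
  | zero => rfl
  | coe a => rw [Cone.sliceDist_coe, dist_self, mul_zero]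

theorem Cone.sliceDist_comm {a b : Cone Y} (h : Cone.mass a = Cone.mass b) :
    Cone.sliceDist a b = Cone.sliceDist b a := by
  cases a using WithZero.recZeroCoe with
  | zero => rw [Cone.eq_zero_of_mass_eq_zero h.symm]
  | coe a =>
    obtain ⟨b, rfl, hb⟩ := Cone.coe_of_mass_eq h
    rw [Cone.sliceDist_coe, Cone.sliceDist_coe, hb, dist_comm]

theorem Cone.sliceDist_triangle {a b c : Cone Y} (h : Cone.mass a = Cone.mass b)
    (h' : Cone.mass a = Cone.mass c) :
    Cone.sliceDist a c ≤ Cone.sliceDist a b + Cone.sliceDist b c := by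
  cases a using WithZero.recZeroCoe with
  | zero => exact add_nonneg (Cone.sliceDist_nonneg _ _) (Cone.sliceDist_nonneg _ _)
  | coe a =>
    obtain ⟨b, rfl, hb⟩ := Cone.coe_of_mass_eq h
    obtain ⟨c, rfl, hc⟩ := Cone.coe_of_mass_eq h'
    simp only [Cone.sliceDist_coe, hb]
    rw [← mul_add]
    exact mul_le_mul_of_nonneg_left (dist_triangle _ _ _) a.pos.le

theorem Cone.sliceDist_smul (t : ℝ≥0) (a b : Cone Y) :
    Cone.sliceDist (t • a) (t • b) = t * Cone.sliceDist a b := by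
  rcases eq_zero_or_pos t with rfl | ht
  · simp only [Cone.zero_smul', NNReal.coe_zero, zero_mul, Cone.sliceDist_self]
  cases a using WithZero.recZeroCoe with
  | zero => rw [Cone.smul_zero']; exact (mul_zero _).symm
  | coe a =>
    cases b using WithZero.recZeroCoe with
    | zero => rw [Cone.smul_zero', Cone.smul_coe ht]; exact (mul_zero _).symm
    | coe b => rw [Cone.smul_coe ht, Cone.smul_coe ht]; exact mul_assoc _ _ _

theorem Cone.sliceDist_of (x y : Y) : Cone.sliceDist (Cone.of x) (Cone.of y) = dist x y :=
  one_mul _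

variable [ConvexCombSpace Y]

theorem div_add_mem_Ioo {r s : ℝ} (hr : 0 < r) (hs : 0 < s) : r / (r + s) ∈ Set.Ioo (0 : ℝ) 1 :=
  ⟨by positivity, by rw [div_lt_one (by positivity)]; linarith⟩

noncomputable instance : Add (Ray Y) where
  add a b := ⟨a.mass + b.mass, add_pos a.pos b.pos, mix (a.mass / (a.mass + b.mass)) a.pt b.pt⟩

theorem Ray.mass_add (a b : Ray Y) : (a + b).mass = a.mass + b.mass := rfl

theorem Ray.pt_add (a b : Ray Y) :
    (a + b).pt = mix (a.mass / (a.mass + b.mass)) a.pt b.pt := rfl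

/-- Associativity is `mix_assoc` for the three masses divided by their total. -/
noncomputable instance : AddCommSemigroup (Ray Y) where
  add_assoc a b c := by
    have ha := a.pos
    have hb := b.pos
    have hc := c.pos
    ext
    · exact add_assoc _ _ _
    · simp only [Ray.pt_add, Ray.mass_add]
      have h := mix_assoc (a := a.mass / (a.mass + b.mass + c.mass))
        (b := b.mass / (a.mass + b.mass + c.mass)) (c := c.mass / (a.mass + b.mass + c.mass))
        (by positivity) (by positivity) (by positivity) (by field_simp) a.pt b.pt c.pt
      rw [← add_div, ← add_div, div_div_div_cancel_right₀ (by positivity),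
        div_div_div_cancel_right₀ (by positivity)] at h
      rw [← h, add_assoc]
  add_comm a b := by
    have ha := a.pos
    have hb := b.pos
    ext
    · exact add_comm _ _
    · simp only [Ray.pt_add]
      rw [mix_comm (div_add_mem_Ioo ha hb)]
      congr 1
      field_simp
      ring

/-- Idempotence enters only through `(s + t) • a = s • a + t • a`, where the two summands have the
same point. -/
noncomputable instance [IsConvexified Y] : Module ℝ≥0 (Cone Y) where
  one_smul a := by
    cases a using WithZero.recZeroCoe with
    | zero => exact Cone.smul_zero' _
    | coe a =>
      rw [Cone.smul_coe one_pos]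
      congr 1
      ext <;> simp
  mul_smul s t a := by
    cases a using WithZero.recZeroCoe with
    | zero => simp only [Cone.smul_zero']
    | coe a =>
      rcases eq_zero_or_pos s with rfl | hs
      · simp only [zero_mul, Cone.zero_smul']
      rcases eq_zero_or_pos t with rfl | ht
      · simp only [mul_zero, Cone.zero_smul', Cone.smul_zero']
      rw [Cone.smul_coe ht, Cone.smul_coe hs, Cone.smul_coe (mul_pos hs ht)]
      congr 1
      ext
      · simp [mul_assoc]
      · rfl
  smul_zero := Cone.smul_zero'
  smul_add t a b := by
    rcases eq_zero_or_pos t with rfl | ht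
    · simp only [Cone.zero_smul', add_zero]
    cases a using WithZero.recZeroCoe with
    | zero => simp only [Cone.smul_zero', zero_add]
    | coe a =>
      cases b using WithZero.recZeroCoe with
      | zero => simp only [Cone.smul_zero', add_zero]
      | coe b =>
        rw [← WithZero.coe_add, Cone.smul_coe ht, Cone.smul_coe ht, Cone.smul_coe ht,
          ← WithZero.coe_add]
        congr 1
        ext
        · exact mul_add _ _ _
        · simp only [Ray.pt_add]
          rw [← mul_add, mul_div_mul_left _ _ (by positivity)]
  add_smul s t a := by
    rcases eq_zero_or_pos s with rfl | hs
    · simp only [Cone.zero_smul', zero_add]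
    rcases eq_zero_or_pos t with rfl | ht
    · simp only [Cone.zero_smul', add_zero]
    cases a using WithZero.recZeroCoe with
    | zero => simp only [Cone.smul_zero', zero_add]
    | coe a =>
      rw [Cone.smul_coe ht, Cone.smul_coe hs, Cone.smul_coe (add_pos hs ht), ← WithZero.coe_add]
      congr 1
      have ha := a.pos
      ext
      · simp [Ray.mass_add, add_mul]
      · simp only [Ray.pt_add]
        rw [mix_self (div_add_mem_Ioo (by positivity) (by positivity))]
  zero_smul := Cone.zero_smul'

theorem Cone.of_mix {l : ℝ≥0} (hl : (l : ℝ) ∈ Set.Ioo (0 : ℝ) 1) (x y : Y) :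
    Cone.of (mix (l : ℝ) x y) = l • Cone.of x + (1 - l) • Cone.of y := by
  have h1 : l < 1 := by exact_mod_cast hl.2
  have h2 : ((1 - l : ℝ≥0) : ℝ) = 1 - l := NNReal.coe_sub h1.le
  rw [Cone.of, Cone.of, Cone.of, Cone.smul_coe (by exact_mod_cast hl.1),
    Cone.smul_coe (tsub_pos_of_lt h1), ← WithZero.coe_add]
  congr 1
  ext
  · simp [Ray.mass_add, h2]
  · simp [Ray.pt_add, h2]

theorem Cone.mass_add (a b : Cone Y) : Cone.mass (a + b) = Cone.mass a + Cone.mass b := by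
  cases a using WithZero.recZeroCoe with
  | zero => simp [Cone.mass_zero]
  | coe a =>
    cases b using WithZero.recZeroCoe with
    | zero => simp [Cone.mass_zero]
    | coe b => rfl

/-- This is axiom (iv) with equal second points: the factor `a.mass / (a.mass + c.mass)` it produces
is offset by the larger mass of the sums. -/
theorem Cone.sliceDist_add_right_le {a b : Cone Y} (h : Cone.mass a = Cone.mass b) (c : Cone Y) :
    Cone.sliceDist (a + c) (b + c) ≤ Cone.sliceDist a b := by
  cases a using WithZero.recZeroCoe with
  | zero =>
    rw [Cone.eq_zero_of_mass_eq_zero h.symm, Cone.sliceDist_self, Cone.sliceDist_self]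
  | coe a =>
    obtain ⟨b, rfl, hb⟩ := Cone.coe_of_mass_eq h
    cases c using WithZero.recZeroCoe with
    | zero => rw [add_zero, add_zero]
    | coe c =>
      have hpos : 0 < a.mass + c.mass := add_pos a.pos c.pos
      rw [← WithZero.coe_add, ← WithZero.coe_add, Cone.sliceDist_coe, Cone.sliceDist_coe,
        Ray.mass_add, Ray.pt_add, Ray.pt_add, hb]
      have h1 := dist_mix_le (div_add_mem_Ioo a.pos c.pos) a.pt c.pt b.pt c.pt
      rw [dist_self, mul_zero, add_zero] at h1
      calc _ ≤ (a.mass + c.mass) * (a.mass / (a.mass + c.mass) * dist a.pt b.pt) :=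
            mul_le_mul_of_nonneg_left h1 hpos.le
        _ = _ := by field_simp

/-- The translation invariant distance on the cone that extends the one of `Y` and vanishes between
the multiples of `o`. -/
noncomputable def Cone.relDist (o : Y) (a b : Cone Y) : ℝ :=
  Cone.sliceDist (a + Cone.mass b • Cone.of o) (b + Cone.mass a • Cone.of o)

theorem Cone.mass_add_smul_of (o : Y) (a : Cone Y) (t : ℝ≥0) :
    Cone.mass (a + t • Cone.of o) = Cone.mass a + t := by
  rw [Cone.mass_add, Cone.mass_smul, Cone.mass_of, mul_one]

theorem Cone.relDist_nonneg (o : Y) (a b : Cone Y) : 0 ≤ Cone.relDist o a b :=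
  Cone.sliceDist_nonneg _ _

theorem Cone.relDist_self (o : Y) (a : Cone Y) : Cone.relDist o a a = 0 :=
  Cone.sliceDist_self _

theorem Cone.relDist_comm (o : Y) (a b : Cone Y) : Cone.relDist o a b = Cone.relDist o b a :=
  Cone.sliceDist_comm (by rw [Cone.mass_add_smul_of, Cone.mass_add_smul_of, add_comm])

variable [IsConvexified Y]

/-- The copies of `a` are exchanged for `b` one at a time. The single summand `c` accompanies each
exchange, which therefore costs at most the distance from `a + c` to `b + c`. -/
theorem Cone.sliceDist_nsmul_add_le {a b : Cone Y} (h : Cone.mass a = Cone.mass b) (c : Cone Y)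
    (n : ℕ) : Cone.sliceDist ((n : ℝ≥0) • a + c) ((n : ℝ≥0) • b + c) ≤
      n * Cone.sliceDist (a + c) (b + c) := by
  induction n with
  | zero => simp [Cone.sliceDist_self]
  | succ n ih =>
    have hm : Cone.mass ((n : ℝ≥0) • a) = Cone.mass ((n : ℝ≥0) • b) := by
      rw [Cone.mass_smul, Cone.mass_smul, h]
    have e1 : ((n + 1 : ℕ) : ℝ≥0) • a + c = (a + c) + (n : ℝ≥0) • a := by
      push_cast; rw [add_smul, one_smul]; abel
    have e2 : ((n + 1 : ℕ) : ℝ≥0) • b + c = ((n : ℝ≥0) • b + c) + b := by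
      push_cast; rw [add_smul, one_smul]; abel
    have e3 : (b + c) + (n : ℝ≥0) • a = ((n : ℝ≥0) • a + c) + b := by abel
    have h1 := Cone.sliceDist_add_right_le (a := a + c) (b := b + c)
      (by rw [Cone.mass_add, Cone.mass_add, h]) ((n : ℝ≥0) • a)
    have h2 := Cone.sliceDist_add_right_le (a := (n : ℝ≥0) • a + c) (b := (n : ℝ≥0) • b + c)
      (by rw [Cone.mass_add, Cone.mass_add, hm]) b
    have h3 := Cone.sliceDist_triangle (a := (a + c) + (n : ℝ≥0) • a)
      (b := (b + c) + (n : ℝ≥0) • a) (c := ((n : ℝ≥0) • b + c) + b)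
      (by simp only [Cone.mass_add, h]) (by simp only [Cone.mass_add, h, hm]; ring)
    rw [e1, e2]
    rw [← e3] at h2
    push_cast
    linarith

/-- By idempotence and axiom (iv), mixing `c.pt` into a point moves it by at most `1 - l` times its
distance to `c.pt`. The resulting error is proportional to `c.mass`, so it disappears when `c` is
scaled down to zero. -/
theorem Ray.mass_mul_dist_le (a b c : Ray Y) (hb : b.mass = a.mass) :
    a.mass * dist a.pt b.pt ≤
      Cone.sliceDist ((a : Cone Y) + (c : Cone Y)) ((b : Cone Y) + (c : Cone Y)) +
      c.mass * (dist a.pt c.pt + dist b.pt c.pt) := by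
  have hpos : 0 < a.mass + c.mass := add_pos a.pos c.pos
  rw [← WithZero.coe_add, ← WithZero.coe_add, Cone.sliceDist_coe, Ray.mass_add, Ray.pt_add,
    Ray.pt_add, hb]
  have hl := div_add_mem_Ioo a.pos c.pos
  set l := a.mass / (a.mass + c.mass) with hldef
  have key : ∀ x : Y, dist (mix l x c.pt) x ≤ (1 - l) * dist x c.pt := by
    intro x
    have := dist_mix_le hl x c.pt x x
    rwa [mix_self hl, dist_self, mul_zero, zero_add, dist_comm c.pt] at this
  have h1 := key a.pt
  have h2 := key b.pt
  have h3 := dist_triangle4 a.pt (mix l a.pt c.pt) (mix l b.pt c.pt) b.pt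
  rw [dist_comm a.pt (mix l a.pt c.pt)] at h3
  have h4 : (a.mass + c.mass) * (1 - l) = c.mass := by rw [hldef]; field_simp; ring
  have h5 : dist a.pt b.pt ≤ dist (mix l a.pt c.pt) (mix l b.pt c.pt) +
      (1 - l) * (dist a.pt c.pt + dist b.pt c.pt) := by linarith
  have h6 := mul_le_mul_of_nonneg_left h5 hpos.le
  rw [mul_add, ← mul_assoc _ (1 - l), h4] at h6
  -- The bound `h6` carries the factor `a.mass + c.mass` on the left; the surplus is nonnegative and
  -- is dropped.
  have := mul_nonneg c.pos.le (dist_nonneg (x := a.pt) (y := b.pt))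
  linarith

/-- The inequality `≥` is a cancellation law, and it is what makes a norm possible. By homogeneity,
`Cone.sliceDist_nsmul_add_le` allows `c` to be replaced by `c / (n + 1)` without exceeding the
distance from `a + c` to `b + c`; then `n → ∞`. -/
theorem Cone.sliceDist_add_right {a b : Cone Y} (h : Cone.mass a = Cone.mass b) (c : Cone Y) :
    Cone.sliceDist (a + c) (b + c) = Cone.sliceDist a b := by
  refine le_antisymm (Cone.sliceDist_add_right_le h c) ?_
  have key : ∀ n : ℕ, Cone.sliceDist (a + ((n : ℝ≥0) + 1)⁻¹ • c) (b + ((n : ℝ≥0) + 1)⁻¹ • c) ≤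
      Cone.sliceDist (a + c) (b + c) := by
    intro n
    have h1 := Cone.sliceDist_nsmul_add_le h c (n + 1)
    have hn : ((n : ℝ≥0) + 1) ≠ 0 := by positivity
    have e : ∀ x : Cone Y, ((n + 1 : ℕ) : ℝ≥0) • x + c =
        ((n : ℝ≥0) + 1) • (x + ((n : ℝ≥0) + 1)⁻¹ • c) := by
      intro x
      push_cast
      rw [smul_add, smul_smul, mul_inv_cancel₀ hn, one_smul]
    rw [e, e, Cone.sliceDist_smul] at h1
    push_cast at h1
    exact le_of_mul_le_mul_left h1 (by positivity)
  cases a using WithZero.recZeroCoe with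
  | zero => exact Cone.sliceDist_nonneg _ _
  | coe a =>
    obtain ⟨b, rfl, hb⟩ := Cone.coe_of_mass_eq h
    cases c using WithZero.recZeroCoe with
    | zero => rw [add_zero, add_zero]
    | coe c =>
      rw [Cone.sliceDist_coe]
      have hlim : Tendsto (fun n : ℕ =>
          Cone.sliceDist ((a : Cone Y) + (c : Cone Y)) ((b : Cone Y) + (c : Cone Y)) +
          (1 / ((n : ℝ) + 1)) * (c.mass * (dist a.pt c.pt + dist b.pt c.pt))) atTop
          (𝓝 (Cone.sliceDist ((a : Cone Y) + (c : Cone Y)) ((b : Cone Y) + (c : Cone Y)))) := by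
        have := (tendsto_one_div_add_atTop_nhds_zero_nat (𝕜 := ℝ)).mul_const
          (c.mass * (dist a.pt c.pt + dist b.pt c.pt))
        simpa using this.const_add _
      refine ge_of_tendsto' hlim fun n => ?_
      have hn : 0 < ((n : ℝ≥0) + 1)⁻¹ := by positivity
      have h1 := key n
      rw [Cone.smul_coe hn] at h1
      refine (Ray.mass_mul_dist_le a b ⟨_, mul_pos hn c.pos, c.pt⟩ hb).trans ?_
      have e : (((n : ℝ≥0) + 1)⁻¹ : ℝ≥0) * c.mass * (dist a.pt c.pt + dist b.pt c.pt) =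
          (1 / ((n : ℝ) + 1)) * (c.mass * (dist a.pt c.pt + dist b.pt c.pt)) := by
        push_cast; ring
      rw [← e]
      exact add_le_add_left h1 _

theorem Cone.relDist_add_right (o : Y) (a b c : Cone Y) :
    Cone.relDist o (a + c) (b + c) = Cone.relDist o a b := by
  have e : ∀ x y : Cone Y, x + c + Cone.mass (y + c) • Cone.of o =
      (x + Cone.mass y • Cone.of o) + (c + Cone.mass c • Cone.of o) := by
    intro x y
    rw [Cone.mass_add, add_smul]; abel
  rw [Cone.relDist, e, e, Cone.sliceDist_add_right]
  · rfl
  · rw [Cone.mass_add_smul_of, Cone.mass_add_smul_of, add_comm]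

/-- Adding to each comparison the multiple of `o` given by the third mass brings all three elements
to the same total mass. Cancellation shows that this changes none of the distances, so the triangle
inequality on one slice applies. -/
theorem Cone.relDist_triangle (o : Y) (a b c : Cone Y) :
    Cone.relDist o a c ≤ Cone.relDist o a b + Cone.relDist o b c := by
  have hm : ∀ x y : Cone Y, Cone.mass (x + Cone.mass y • Cone.of o) =
      Cone.mass (y + Cone.mass x • Cone.of o) := fun x y => by
    rw [Cone.mass_add_smul_of, Cone.mass_add_smul_of, add_comm]
  have e : ∀ x y z : Cone Y, Cone.relDist o x y = Cone.sliceDist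
      (x + Cone.mass y • Cone.of o + Cone.mass z • Cone.of o)
      (y + Cone.mass x • Cone.of o + Cone.mass z • Cone.of o) := fun x y z =>
    (Cone.sliceDist_add_right (hm x y) _).symm
  rw [e a c b, e a b c, e b c a, add_right_comm a, add_right_comm b (Cone.mass c • Cone.of o),
    add_right_comm c (Cone.mass b • Cone.of o)]
  apply Cone.sliceDist_triangle <;> simp only [Cone.mass_add_smul_of] <;> ring

theorem Cone.relDist_smul (o : Y) (t : ℝ≥0) (a b : Cone Y) :
    Cone.relDist o (t • a) (t • b) = t * Cone.relDist o a b := by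
  rw [Cone.relDist, Cone.mass_smul, Cone.mass_smul, mul_smul, mul_smul, ← smul_add, ← smul_add,
    Cone.sliceDist_smul, Cone.relDist]

theorem Cone.relDist_of (o x y : Y) :
    Cone.relDist o (Cone.of x) (Cone.of y) = dist x y := by
  rw [Cone.relDist, Cone.mass_of, Cone.mass_of, Cone.sliceDist_add_right (by rfl),
    Cone.sliceDist_of]

end Cone

/-- The vector space of formal linear combinations of points of `Y`, to be normed by means of the
base point `o`, which plays the role of the origin. -/
def FreeSpace (Y : Type*) (_o : Y) := Y →₀ ℝ

/-! ### The seminormed space of formal linear combinations -/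

namespace FreeSpace

variable {Y : Type*} {o : Y}

noncomputable instance : AddCommGroup (FreeSpace Y o) := inferInstanceAs (AddCommGroup (Y →₀ ℝ))

noncomputable instance : Module ℝ (FreeSpace Y o) := inferInstanceAs (Module ℝ (Y →₀ ℝ))

/-- The coefficients of a formal linear combination. -/
noncomputable def coeff : FreeSpace Y o ≃ₗ[ℝ] (Y →₀ ℝ) := LinearEquiv.refl ℝ (Y →₀ ℝ)

/-- The positive part of a formal linear combination. -/
noncomputable def posPart (f : FreeSpace Y o) : Y →₀ ℝ≥0 :=
  (coeff f).mapRange Real.toNNReal Real.toNNReal_zero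

theorem coeff_apply_eq (f : FreeSpace Y o) (y : Y) :
    coeff f y = (posPart f y : ℝ) - (posPart (-f) y : ℝ) := by
  simp only [posPart, Finsupp.mapRange_apply, map_neg, Finsupp.neg_apply, Real.coe_toNNReal']
  exact (max_zero_sub_max_neg_zero_eq_self (coeff f y)).symm

variable (o) in
/-- The point `x` as an element of the free space. -/
noncomputable def point (x : Y) : FreeSpace Y o := coeff.symm (Finsupp.single x 1)

theorem coeff_point (x : Y) : coeff (point o x) = Finsupp.single x 1 := coeff.apply_symm_apply _

theorem span_range_point : Submodule.span ℝ (Set.range (point o)) = ⊤ := by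
  rw [eq_top_iff]
  rintro f -
  rw [← coeff.symm_apply_apply f]
  induction coeff f using Finsupp.induction_linear with
  | zero => simp
  | add f g hf hg => rw [map_add]; exact Submodule.add_mem _ hf hg
  | single x r =>
    rw [← mul_one r, ← smul_eq_mul, ← Finsupp.smul_single, map_smul]
    exact Submodule.smul_mem _ r (Submodule.subset_span ⟨x, rfl⟩)

variable [MetricSpace Y] [ConvexCombSpace Y] [IsConvexified Y]

/-- The value in the cone of a formal linear combination with nonnegative coefficients. -/
noncomputable def coneValue : (Y →₀ ℝ≥0) →ₗ[ℝ≥0] Cone Y :=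
  Finsupp.linearCombination ℝ≥0 Cone.of

theorem coneValue_single (x : Y) (t : ℝ≥0) :
    coneValue (Finsupp.single x t) = t • Cone.of x :=
  Finsupp.linearCombination_single _ _ _

/-- In general this is only a seminorm: a formal combination and the point it represents differ by a
vector of norm zero, and `point o o` has norm zero. The completion makes the identifications. -/
noncomputable instance : Norm (FreeSpace Y o) where
  norm f := Cone.relDist o (coneValue (posPart f)) (coneValue (posPart (-f)))

/-- Any decomposition `f = g - h` computes the norm, because `f⁺ + h = g + f⁻` and the distance on
the cone is translation invariant. Homogeneity and the triangle inequality rely on this freedom. -/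
theorem norm_eq_relDist (f : FreeSpace Y o) (g h : Y →₀ ℝ≥0)
    (H : ∀ y, coeff f y = (g y : ℝ) - (h y : ℝ)) :
    ‖f‖ = Cone.relDist o (coneValue g) (coneValue h) := by
  have e : posPart f + h = g + posPart (-f) := by
    ext y
    have := coeff_apply_eq f y
    have := H y
    simp only [Finsupp.add_apply, NNReal.coe_add]
    linarith
  have e' := congrArg coneValue e
  rw [map_add, map_add] at e'
  change Cone.relDist o (coneValue (posPart f)) (coneValue (posPart (-f))) = _
  rw [← Cone.relDist_add_right o _ _ (coneValue h), e',
    add_comm (coneValue (posPart (-f))) (coneValue h), Cone.relDist_add_right]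

theorem norm_smul_of_nonneg (t : ℝ≥0) (f : FreeSpace Y o) : ‖(t : ℝ) • f‖ = t * ‖f‖ := by
  rw [norm_eq_relDist ((t : ℝ) • f) (t • posPart f) (t • posPart (-f)), map_smul, map_smul,
    Cone.relDist_smul]
  · rfl
  · intro y
    rw [map_smul, Finsupp.smul_apply, coeff_apply_eq f y]
    simp [mul_sub]

theorem norm_neg' (f : FreeSpace Y o) : ‖-f‖ = ‖f‖ := by
  rw [norm_eq_relDist (-f) (posPart (-f)) (posPart f), Cone.relDist_comm]
  · rfl
  · intro y
    rw [map_neg, Finsupp.neg_apply, coeff_apply_eq f y]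
    ring

theorem seminormedSpaceCore : SeminormedSpace.Core ℝ (FreeSpace Y o) where
  norm_nonneg _ := Cone.relDist_nonneg _ _ _
  norm_smul c f := by
    rcases le_total 0 c with hc | hc
    · rw [Real.norm_of_nonneg hc]
      exact norm_smul_of_nonneg ⟨c, hc⟩ f
    · rw [Real.norm_of_nonpos hc, ← norm_neg', ← neg_smul]
      exact norm_smul_of_nonneg ⟨-c, neg_nonneg.2 hc⟩ f
  norm_triangle f g := by
    rw [norm_eq_relDist (f + g) (posPart f + posPart g) (posPart (-f) + posPart (-g)), map_add,
      map_add]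
    -- With `f⁻ + g⁺` as intermediate element, cancelling the common summand leaves the norms of `f`
    -- and `g`.
    · refine (Cone.relDist_triangle o _ (coneValue (posPart (-f)) + coneValue (posPart g)) _).trans
        (le_of_eq ?_)
      rw [Cone.relDist_add_right, add_comm (coneValue (posPart (-f))),
        add_comm (coneValue (posPart (-f))), Cone.relDist_add_right]
      rfl
    · intro y
      rw [map_add, Finsupp.add_apply, coeff_apply_eq f y, coeff_apply_eq g y]
      simp only [Finsupp.add_apply, NNReal.coe_add]
      ring

noncomputable instance : SeminormedAddCommGroup (FreeSpace Y o) :=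
  SeminormedAddCommGroup.ofCore seminormedSpaceCore

noncomputable instance : NormedSpace ℝ (FreeSpace Y o) where
  norm_smul_le c f := (seminormedSpaceCore.norm_smul c f).le

theorem norm_point_sub_point (x y : Y) : ‖point o x - point o y‖ = dist x y := by
  rw [norm_eq_relDist _ (Finsupp.single x 1) (Finsupp.single y 1), coneValue_single,
    coneValue_single, one_smul, one_smul, Cone.relDist_of]
  intro z
  classical
  simp only [map_sub, coeff_point, Finsupp.sub_apply, Finsupp.single_apply]
  split_ifs <;> simp

theorem isometry_point : Isometry (point o) :=
  Isometry.of_dist_eq fun x y => by rw [dist_eq_norm, norm_point_sub_point]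

/-- The two combinations have the same value in the cone, by `Cone.of_mix`. -/
theorem norm_point_mix_sub {l : ℝ} (hl : l ∈ Set.Ioo (0 : ℝ) 1) (x y : Y) :
    ‖point o (mix l x y) - (l • point o x + (1 - l) • point o y)‖ = 0 := by
  lift l to ℝ≥0 using hl.1.le
  have h1 : l ≤ 1 := by exact_mod_cast hl.2.le
  rw [norm_eq_relDist _ (Finsupp.single (mix (l : ℝ) x y) 1)
    (Finsupp.single x l + Finsupp.single y (1 - l)), map_add, coneValue_single, coneValue_single,
    coneValue_single, one_smul, Cone.of_mix hl, Cone.relDist_self]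
  intro z
  classical
  simp only [map_sub, map_add, map_smul, coeff_point, Finsupp.sub_apply, Finsupp.add_apply,
    Finsupp.smul_apply, Finsupp.single_apply, NNReal.coe_add]
  split_ifs <;> simp [NNReal.coe_sub h1]

instance [TopologicalSpace.SeparableSpace Y] :
    TopologicalSpace.SeparableSpace (FreeSpace Y o) := by
  have h := (TopologicalSpace.isSeparable_range (isometry_point (o := o)).continuous).span
    (R := ℝ)
  rw [span_range_point] at h
  exact TopologicalSpace.isSeparable_univ_iff.1 h

end FreeSpace

/-- A complete convex combination space all of whose points are fixed by the convexification
operator embeds affinely and isometrically in a Banach space. -/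
theorem isAffineEmbedding_point {Y : Type*} [MetricSpace Y] [ConvexCombSpace Y] [IsConvexified Y]
    [CompleteSpace Y] (o : Y) :
    IsAffineEmbedding fun x : Y =>
      (FreeSpace.point o x : UniformSpace.Completion (FreeSpace Y o)) := by
  have hiso : Isometry fun x : Y =>
      (FreeSpace.point o x : UniformSpace.Completion (FreeSpace Y o)) :=
    UniformSpace.Completion.coe_isometry.comp FreeSpace.isometry_point
  have hmix : ∀ (x y : Y) (l : ℝ), l ∈ Set.Ioo (0 : ℝ) 1 →
      (FreeSpace.point o (comb ![l, 1 - l] ![x, y]) :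
        UniformSpace.Completion (FreeSpace Y o)) =
      l • (FreeSpace.point o x : UniformSpace.Completion (FreeSpace Y o)) +
        (1 - l) • (FreeSpace.point o y : UniformSpace.Completion (FreeSpace Y o)) := by
    intro x y l hl
    -- The completion is separated, so a difference of seminorm zero becomes an equality there.
    rw [← UniformSpace.Completion.coe_smul, ← UniformSpace.Completion.coe_smul,
      ← UniformSpace.Completion.coe_add, ← sub_eq_zero, ← norm_eq_zero,
      ← UniformSpace.Completion.coe_sub, UniformSpace.Completion.norm_coe]
    exact FreeSpace.norm_point_mix_sub hl x y
  refine ⟨hiso.isClosedEmbedding.isClosed_range, ?_, hmix, fun x y => ?_⟩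
  · rw [convex_iff_forall_pos]
    rintro _ ⟨x, rfl⟩ _ ⟨y, rfl⟩ a b ha hb hab
    obtain rfl : b = 1 - a := by linarith
    exact ⟨_, hmix x y a ⟨ha, by linarith⟩⟩
  · rw [← hiso.dist_eq, dist_eq_norm]

/-! ### Integrable random elements and nearest-point approximation -/

section Integrability

variable {Z E Ω : Type*} [MetricSpace Z] [MeasurableSpace Z] [NormedAddCommGroup E]
  [MeasurableSpace Ω]

theorem IsIntegrableElement.integrable_dist [OpensMeasurableSpace Z] {P : Measure Ω}
    [IsFiniteMeasure P] {X : Ω → Z} (hX : IsIntegrableElement P X) (b : Z) :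
    Integrable (fun ω => dist b (X ω)) P := by
  obtain ⟨a, ha⟩ := hX.integrable
  refine ((integrable_const (dist b a)).add ha).mono' ?_ (Eventually.of_forall fun ω => ?_)
  · exact ((continuous_const.dist continuous_id).measurable.comp
      hX.measurable).aestronglyMeasurable
  · rw [Real.norm_of_nonneg dist_nonneg]
    exact dist_triangle _ _ _

/-- Nonexpansive images of integrable random elements are integrable. -/
theorem IsIntegrableElement.integrable_comp [OpensMeasurableSpace Z]
    [SecondCountableTopology Z] {P : Measure Ω} [IsFiniteMeasure P] {X : Ω → Z}
    (hX : IsIntegrableElement P X) {h : Z → E} (hlip : ∀ x y, dist (h x) (h y) ≤ dist x y) :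
    Integrable (fun ω => h (X ω)) P := by
  obtain ⟨a, ha⟩ := hX.integrable
  have hc : Continuous h :=
    (LipschitzWith.of_dist_le_mul (K := 1) fun x y => by simpa using hlip x y).continuous
  refine ((integrable_const ‖h a‖).add ha).mono' ?_ (Eventually.of_forall fun ω => ?_)
  · exact (hc.comp_stronglyMeasurable hX.measurable.stronglyMeasurable).aestronglyMeasurable
  · have h1 := norm_le_norm_add_norm_sub' (h (X ω)) (h a)
    rw [← dist_eq_norm, dist_comm] at h1
    exact h1.trans (add_le_add_right (hlip _ _) _)

variable [NormedSpace ℝ E]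

theorem tendsto_integral_nearestPt [OpensMeasurableSpace Z] {P : Measure Ω} [IsFiniteMeasure P]
    {X : Ω → Z} (hX : IsIntegrableElement P X) {h : Z → E}
    (hlip : ∀ x y, dist (h x) (h y) ≤ dist x y) {u : ℕ → Z} (hu : DenseRange u) :
    Tendsto (fun n => ∫ ω, h ((SimpleFunc.nearestPt u n).comp X hX.measurable ω) ∂P) atTop
      (𝓝 (∫ ω, h (X ω) ∂P)) := by
  have hc : Continuous h :=
    (LipschitzWith.of_dist_le_mul (K := 1) fun x y => by simpa using hlip x y).continuous
  refine tendsto_integral_of_dominated_convergence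
    -- The point `u 0` is always a candidate, so the nearest point is within `dist (u 0) (X ω)` of
    -- `X ω`, hence within twice that of `u 0`.
    (fun ω => ‖h (u 0)‖ + 2 * dist (u 0) (X ω)) (fun n => ?_) ?_ (fun n => ?_) ?_
  · exact (((SimpleFunc.nearestPt u n).comp X hX.measurable).map h).aestronglyMeasurable
  · exact (integrable_const _).add ((hX.integrable_dist (u 0)).const_mul 2)
  · refine Eventually.of_forall fun ω => ?_
    change ‖h (SimpleFunc.nearestPt u n (X ω))‖ ≤ _
    have h1 := norm_le_norm_add_norm_sub' (h (SimpleFunc.nearestPt u n (X ω))) (h (u 0))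
    rw [← dist_eq_norm] at h1
    have h2 : dist (SimpleFunc.nearestPt u n (X ω)) (X ω) ≤ dist (u 0) (X ω) := by
      have := SimpleFunc.edist_nearestPt_le u (X ω) (Nat.zero_le n)
      rwa [edist_dist, edist_dist, ENNReal.ofReal_le_ofReal_iff dist_nonneg] at this
    have h3 := hlip (SimpleFunc.nearestPt u n (X ω)) (u 0)
    have h4 := dist_triangle_right (SimpleFunc.nearestPt u n (X ω)) (u 0) (X ω)
    linarith
  · refine Eventually.of_forall fun ω => ?_
    exact (hc.tendsto _).comp (SimpleFunc.tendsto_nearestPt (hu _))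

end Integrability

/-! ### Affine maps and expectations of simple random elements -/

section AffineMap

variable {Z E : Type*} [MetricSpace Z] [ConvexCombSpace Z] [NormedAddCommGroup E]
  [NormedSpace ℝ E]

theorem map_comb_eq_sum {h : Z → E}
    (haff : ∀ (x y : Z) (l : ℝ), l ∈ Set.Ioo (0 : ℝ) 1 →
      h (comb ![l, 1 - l] ![x, y]) = l • h x + (1 - l) • h y) {n : ℕ} :
    ∀ (w : Fin n → ℝ) (u : Fin n → Z), IsWeight w → h (comb w u) = ∑ i, w i • h (u i) := by
  match n with
  | 0 => intro w u hw; exact absurd hw.sum_eq_one (by simp)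
  | n + 1 =>
    induction n with
    | zero =>
      intro w u hw
      have e1 : w = ![1] := by
        ext i; fin_cases i; simpa using hw.sum_eq_one
      have e2 : u = ![u 0] := by ext i; fin_cases i; rfl
      rw [e1, e2, comb_one]; simp
    | succ n ih =>
      intro w u hw
      obtain ⟨a, w, rfl⟩ : ∃ (a : ℝ) (w' : Fin (n + 1) → ℝ), w = Fin.cons a w' :=
        ⟨w 0, Fin.tail w, (Fin.cons_self_tail w).symm⟩
      obtain ⟨x, u, rfl⟩ : ∃ (a : Z) (w' : Fin (n + 1) → Z), u = Fin.cons a w' :=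
        ⟨u 0, Fin.tail u, (Fin.cons_self_tail u).symm⟩
      have ha : 0 < a := by simpa using hw.pos 0
      have hpw : ∀ i, 0 < w i := fun i => by simpa using hw.pos i.succ
      have hs := hw.sum_eq_one
      rw [Fin.sum_univ_succ] at hs
      simp only [Fin.cons_zero, Fin.cons_succ] at hs
      have hsw : 0 < ∑ i, w i := Finset.sum_pos (fun i _ => hpw i) Finset.univ_nonempty
      have h1a : 0 < 1 - a := by linarith
      rw [comb_cons _ _ _ _ hw, haff _ _ _ ⟨ha, by linarith⟩, ih (fun i => w i / (1 - a)) u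
        ⟨fun i => div_pos (hpw i) h1a, by
          rw [← Finset.sum_div, div_eq_one_iff_eq h1a.ne']; linarith⟩,
        Fin.sum_univ_succ (n := n + 1)]
      simp only [Fin.cons_zero, Fin.cons_succ, Finset.smul_sum, smul_smul]
      congr 1
      refine Finset.sum_congr rfl fun i _ => ?_
      rw [mul_div_cancel₀ _ h1a.ne']

theorem IsAffineEmbedding.isometry {j : Z → E} (hj : IsAffineEmbedding j) : Isometry j :=
  Isometry.of_dist_eq fun x y => by rw [dist_eq_norm, ← hj.dist_eq]

theorem IsApproxSeq.denseRange {u : ℕ → Z} (hu : IsApproxSeq u) : DenseRange u :=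
  hu.dense.mono (Set.range_comp_subset_range Nat.succ u)

variable {Ω : Type*} [MeasurableSpace Ω]

theorem sum_real_preimage_smul {Z : Type*} [CompleteSpace E] (P : Measure Ω) [IsFiniteMeasure P]
    (X : SimpleFunc Ω Z) (g : Z → E) :
    ∑ x ∈ X.range, P.real (X ⁻¹' {x}) • g x = ∫ ω, g (X ω) ∂P := by
  have e : ∀ ω, g (X ω) = ∑ x ∈ X.range, (X ⁻¹' {x}).indicator (fun _ => g x) ω := by
    intro ω
    rw [Finset.sum_eq_single_of_mem (X ω) (X.mem_range_self ω)]
    · simp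
    · intro x _ hx
      exact Set.indicator_of_notMem (fun h : X ω = x => hx h.symm) _
  simp only [e]
  rw [integral_finsetSum]
  · refine Finset.sum_congr rfl fun x _ => ?_
    rw [integral_indicator_const _ (X.measurableSet_fiber x)]
  · intro x _
    exact (integrable_const _).indicator (X.measurableSet_fiber x)

open Classical in
theorem isWeight_simpleFunc {Z : Type*} (P : Measure Ω) [IsProbabilityMeasure P]
    (X : SimpleFunc Ω Z) :
    IsWeight fun i : Fin (X.range.filter fun x => 0 < P.real (X ⁻¹' {x})).card =>
      P.real (X ⁻¹' {((X.range.filter fun x => 0 < P.real (X ⁻¹' {x})).equivFin.symm i : Z)}) := by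
  set s := X.range.filter fun x => 0 < P.real (X ⁻¹' {x}) with hs
  constructor
  · intro i
    exact (Finset.mem_filter.1 (s.equivFin.symm i).2).2
  · rw [Equiv.sum_comp s.equivFin.symm fun x : s => P.real (X ⁻¹' {(x : Z)}),
      Finset.sum_coe_sort s fun x => P.real (X ⁻¹' {x}), hs, Finset.sum_filter_of_ne]
    -- Integrating the constant `1` shows that the probabilities of all values sum to one.
    · have := sum_real_preimage_smul P X fun _ => (1 : ℝ)
      simpa using this
    · intro x _ hx
      exact lt_of_le_of_ne measureReal_nonneg hx.symm

theorem simpleExpectation_mem_convexDomain (P : Measure Ω) [IsProbabilityMeasure P]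
    (X : SimpleFunc Ω Z) : simpleExpectation P X ∈ convexDomain Z :=
  comb_mem_convexDomain _ _ (isWeight_simpleFunc P X) fun _ => ⟨_, rfl⟩

/-- An affine map which does not distinguish `x` from `K x` takes the expectation of a simple
random element to a Bochner integral. -/
theorem map_simpleExpectation [CompleteSpace E] {h : Z → E}
    (haff : ∀ (x y : Z) (l : ℝ), l ∈ Set.Ioo (0 : ℝ) 1 →
      h (comb ![l, 1 - l] ![x, y]) = l • h x + (1 - l) • h y)
    (hK : ∀ x, h (convexify x) = h x) (P : Measure Ω) [IsProbabilityMeasure P]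
    (X : SimpleFunc Ω Z) : h (simpleExpectation P X) = ∫ ω, h (X ω) ∂P := by
  classical
  rw [simpleExpectation, finsetComb, map_comb_eq_sum haff _ _ (isWeight_simpleFunc P X)]
  simp only [hK]
  set s := X.range.filter fun x => 0 < P.real (X ⁻¹' {x}) with hs
  rw [Equiv.sum_comp s.equivFin.symm fun x : s => P.real (X ⁻¹' {(x : Z)}) • h x,
    Finset.sum_coe_sort s fun x => P.real (X ⁻¹' {x}) • h x, hs, Finset.sum_filter_of_ne,
    sum_real_preimage_smul]
  intro x _ hx
  exact lt_of_le_of_ne measureReal_nonneg fun h0 => hx (by rw [← h0, zero_smul])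

variable [MeasurableSpace Z]

/-- The hypotheses on `h` cover two cases: `j` on an idempotent space and `j ∘ K` on `𝔛`. They give
convergence only after applying `h`; convergence of the expectations themselves needs an isometric
`j` with closed range. -/
theorem tendsto_map_approxExpectation [CompleteSpace E] [OpensMeasurableSpace Z] {P : Measure Ω}
    [IsProbabilityMeasure P] {X : Ω → Z} (hX : IsIntegrableElement P X) {h : Z → E}
    (haff : ∀ (x y : Z) (l : ℝ), l ∈ Set.Ioo (0 : ℝ) 1 →
      h (comb ![l, 1 - l] ![x, y]) = l • h x + (1 - l) • h y)
    (hK : ∀ x, h (convexify x) = h x) (hlip : ∀ x y, dist (h x) (h y) ≤ dist x y)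
    {u : ℕ → Z} (hu : IsApproxSeq u) :
    Tendsto (fun n => h (approxExpectation u P X hX.measurable n)) atTop
      (𝓝 (∫ ω, h (X ω) ∂P)) := by
  refine (tendsto_integral_nearestPt hX hlip hu.denseRange).congr fun n => ?_
  exact (map_simpleExpectation haff hK P _).symm

end AffineMap

/-! ### Existence of expectations -/

section Expectation

variable {𝔛 Ω E : Type*} [MetricSpace 𝔛] [ConvexCombSpace 𝔛] [MeasurableSpace 𝔛]
  [MeasurableSpace Ω] {P : Measure Ω}

theorem tendsto_expectation [OpensMeasurableSpace 𝔛] {u : ℕ → 𝔛} {X : Ω → 𝔛} {hX : Measurable X}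
    {e : 𝔛} (h : Tendsto (approxExpectation u P X hX) atTop (𝓝 e)) :
    Tendsto (approxExpectation u P X hX) atTop (𝓝 (expectation u P X hX)) :=
  haveI : Nonempty 𝔛 := ⟨u 0⟩
  tendsto_nhds_limUnder ⟨e, h⟩

theorem expectation_eq_of_tendsto [OpensMeasurableSpace 𝔛] {u : ℕ → 𝔛} {X : Ω → 𝔛}
    {hX : Measurable X} {e : 𝔛} (h : Tendsto (approxExpectation u P X hX) atTop (𝓝 e)) :
    expectation u P X hX = e :=
  tendsto_nhds_unique (tendsto_expectation h) h

theorem IsIntegrableElement.toDomain [BorelSpace 𝔛] {X : Ω → 𝔛}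
    (hX : IsIntegrableElement P X) : IsIntegrableElement P fun ω => toDomain (X ω) := by
  have hm : Measurable fun ω => ConvexCombSpace.toDomain (X ω) :=
    continuous_toDomain.measurable.comp hX.measurable
  obtain ⟨a, ha⟩ := hX.integrable
  refine ⟨hm, ConvexCombSpace.toDomain a, ha.mono' ?_ (Eventually.of_forall fun ω => ?_)⟩
  · exact ((continuous_const.dist continuous_id).measurable.comp hm).aestronglyMeasurable
  · rw [Real.norm_of_nonneg dist_nonneg]
    exact dist_toDomain_le _ _

theorem IsIntegrableElement.coe {Y : Ω → convexDomain 𝔛} (hY : IsIntegrableElement P Y) :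
    IsIntegrableElement P fun ω => (Y ω : 𝔛) :=
  ⟨measurable_subtype_coe.comp hY.measurable, hY.integrable.elim fun a ha => ⟨a, ha⟩⟩

variable [IsProbabilityMeasure P] [NormedAddCommGroup E] [NormedSpace ℝ E] [CompleteSpace E]

/-- In a convex combination space whose points are fixed by the convexification operator, the
expectation of an integrable random element is its Bochner integral. -/
theorem IsAffineEmbedding.exists_tendsto_approxExpectation [IsConvexified 𝔛]
    [OpensMeasurableSpace 𝔛] {j : 𝔛 → E} (hj : IsAffineEmbedding j) {v : ℕ → 𝔛}
    (hv : IsApproxSeq v) {Y : Ω → 𝔛} (hY : IsIntegrableElement P Y) :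
    ∃ e : 𝔛, j e = ∫ ω, j (Y ω) ∂P ∧
      Tendsto (approxExpectation v P Y hY.measurable) atTop (𝓝 e) := by
  have h := tendsto_map_approxExpectation hY hj.map_comb
    (fun x => by rw [IsConvexified.convexify_eq]) (fun x y => (hj.isometry.dist_eq x y).le) hv
  -- Closedness of the range supplies the limit point; the isometry `j` then reflects the
  -- convergence.
  obtain ⟨e, he⟩ : ∫ ω, j (Y ω) ∂P ∈ Set.range j :=
    hj.isClosed_range.mem_of_tendsto h (Eventually.of_forall fun n => ⟨_, rfl⟩)
  refine ⟨e, he, ?_⟩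
  rw [hj.isometry.isEmbedding.tendsto_nhds_iff, he]
  exact h

/-- Applying the limit theorem to `j ∘ K` shows that the images under `K` of the simple expectations
converge. These expectations already lie in `K(𝔛)`, so `K` fixes them and they converge in `𝔛`
themselves. -/
theorem IsAffineEmbedding.exists_tendsto_approxExpectation_toDomain [OpensMeasurableSpace 𝔛]
    {j : convexDomain 𝔛 → E} (hj : IsAffineEmbedding j) {u : ℕ → 𝔛} (hu : IsApproxSeq u)
    {X : Ω → 𝔛} (hX : IsIntegrableElement P X) :
    ∃ e : convexDomain 𝔛, j e = ∫ ω, j (toDomain (X ω)) ∂P ∧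
      Tendsto (approxExpectation u P X hX.measurable) atTop (𝓝 (e : 𝔛)) := by
  have h := tendsto_map_approxExpectation (h := fun x => j (toDomain x)) hX
    (fun x y l hl => by rw [toDomain_comb_two hl, hj.map_comb _ _ _ hl])
    (fun x => congrArg j (toDomain_coe (toDomain x)))
    (fun x y => (hj.isometry.dist_eq _ _).le.trans (dist_toDomain_le x y)) hu
  obtain ⟨e, he⟩ : ∫ ω, j (toDomain (X ω)) ∂P ∈ Set.range j :=
    hj.isClosed_range.mem_of_tendsto h (Eventually.of_forall fun n => ⟨_, rfl⟩)
  refine ⟨e, he, ?_⟩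
  have h1 : Tendsto (fun n => toDomain (approxExpectation u P X hX.measurable n)) atTop (𝓝 e) := by
    rw [hj.isometry.isEmbedding.tendsto_nhds_iff, he]
    exact h
  refine ((continuous_subtype_val.tendsto e).comp h1).congr fun n => ?_
  exact mem_convexDomain_iff.1 (simpleExpectation_mem_convexDomain P _)

end Expectation

end ConvexCombSpace
theorem theorem4p1 {𝔛 : Type u₁} [MetricSpace 𝔛] [CompleteSpace 𝔛]
    [TopologicalSpace.SeparableSpace 𝔛] [ConvexCombSpace 𝔛] [MeasurableSpace 𝔛] [BorelSpace 𝔛]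
    {Ω : Type u₂} [MeasurableSpace Ω] (P : Measure Ω) [IsProbabilityMeasure P]
    (u : ℕ → 𝔛) (hu : IsApproxSeq u)
    (v : ℕ → convexDomain 𝔛) (hv : IsApproxSeq v) :
    -- the embedding of `K(𝔛)` into a separable Banach space exists
    (∃ (E : Type u₁) (_ : NormedAddCommGroup E) (_ : NormedSpace ℝ E) (j : convexDomain 𝔛 → E),
      CompleteSpace E ∧ TopologicalSpace.SeparableSpace E ∧ IsAffineEmbedding j) ∧
    -- and every such embedding satisfies the identities
    ∀ (E : Type u₃) [NormedAddCommGroup E] [NormedSpace ℝ E] [CompleteSpace E]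
      (j : convexDomain 𝔛 → E), IsAffineEmbedding j →
      (∀ (X : Ω → 𝔛) (hX : IsIntegrableElement P X),
        ∃ (hKX : IsIntegrableElement P fun ω => toDomain (X ω))
          (hmem : expectation u P X hX.measurable ∈ convexDomain 𝔛),
          Tendsto (approxExpectation u P X hX.measurable) atTop
            (𝓝 (expectation u P X hX.measurable)) ∧
          Tendsto (approxExpectation v P (fun ω => toDomain (X ω)) hKX.measurable) atTop
            (𝓝 (expectation v P (fun ω => toDomain (X ω)) hKX.measurable)) ∧
          Integrable (fun ω => j (toDomain (X ω))) P ∧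
          j ⟨expectation u P X hX.measurable, hmem⟩ =
            j (expectation v P (fun ω => toDomain (X ω)) hKX.measurable) ∧
          j (expectation v P (fun ω => toDomain (X ω)) hKX.measurable) =
            ∫ ω, j (toDomain (X ω)) ∂P) ∧
      (∀ (Y : Ω → convexDomain 𝔛) (hY : IsIntegrableElement P Y),
          Tendsto (approxExpectation v P Y hY.measurable) atTop
            (𝓝 (expectation v P Y hY.measurable)) ∧
          Integrable (fun ω => j (Y ω)) P ∧
          -- the expectation of `Y` is the same in `K(𝔛)` and in `𝔛`
          expectation u P (fun ω => (Y ω : 𝔛)) (measurable_subtype_coe.comp hY.measurable) =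
            expectation v P Y hY.measurable ∧
          j (expectation v P Y hY.measurable) = ∫ ω, j (Y ω) ∂P) := by
  have : SecondCountableTopology 𝔛 := UniformSpace.secondCountable_of_separable 𝔛
  have : CompleteSpace (convexDomain 𝔛) := isClosed_convexDomain.completeSpace_coe
  -- Any base point of `K(𝔛)` would do; `v 0` is one at hand.
  refine ⟨⟨UniformSpace.Completion (FreeSpace (convexDomain 𝔛) (v 0)), inferInstance,
    inferInstance, _, inferInstance, inferInstance, isAffineEmbedding_point (v 0)⟩, ?_⟩
  intro E _ _ _ j hj
  have hlip : ∀ x y : convexDomain 𝔛, dist (j x) (j y) ≤ dist x y :=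
    fun x y => (hj.isometry.dist_eq x y).le
  refine ⟨fun X hX => ?_, fun Y hY => ?_⟩
  · obtain ⟨e, he, hte⟩ := hj.exists_tendsto_approxExpectation_toDomain hu hX
    obtain ⟨e', he', hte'⟩ := hj.exists_tendsto_approxExpectation hv hX.toDomain
    have hEX := expectation_eq_of_tendsto hte
    have hEKX := expectation_eq_of_tendsto hte'
    have hmem : expectation u P X hX.measurable ∈ convexDomain 𝔛 := hEX ▸ e.2
    have hj' : j ⟨expectation u P X hX.measurable, hmem⟩ = ∫ ω, j (toDomain (X ω)) ∂P := by
      rw [← he]; exact congrArg j (Subtype.ext hEX)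
    rw [← hEKX] at he'
    exact ⟨hX.toDomain, hmem, tendsto_expectation hte, tendsto_expectation hte',
      hX.toDomain.integrable_comp hlip, hj'.trans he'.symm, he'⟩
  · obtain ⟨e, he, hte⟩ := hj.exists_tendsto_approxExpectation_toDomain hu hY.coe
    obtain ⟨e', he', hte'⟩ := hj.exists_tendsto_approxExpectation hv hY
    have hEY := expectation_eq_of_tendsto hte'
    -- Since `K` fixes the values of `Y`, the limits in `𝔛` and in `K(𝔛)` have the same Bochner
    -- integral as image, and `j` is injective.
    simp only [toDomain_coe] at he
    have hee : e = e' := hj.isometry.injective (he.trans he'.symm)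
    refine ⟨tendsto_expectation hte', hY.integrable_comp hlip, ?_, by rw [hEY, he']⟩
    rw [hEY, ← hee]
    exact expectation_eq_of_tendsto hte
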